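/- Consider a downlink with $B\ge1$ transmitters at points $a_1,\dots,a_B\in\mathbb{R}^2$, $K\ge1$ users at random points $z_1,\dots,z_K\in\mathbb{R}^2$, and $N\ge1$ resource blocks. Fix constants $\alpha>1$, $\beta>0$, $0<r_0<R$, $P>0$ and $0<\kappa_1,\kappa_2$. The network is regular extended: the $a_i$ are distinct points of a regular hexagonal grid (six nearest neighbours per point, neighbour distance $2R$, arbitrary origin and orientation), contained in the disc of radius $p-R$ about the origin, where the network radius $p>R$ satisfies $\kappa_1R\sqrt B\le p\le\kappa_2R\sqrt B$. The users are uniformly distributed in the disc of radius $p$ about the origin. The SNR between user $k$ and transmitter $i$ on resource block $n$ is $$\gamma_{i,k,n}=\beta^2\max\{r_0,|z_k-a_i|\}^{-2\alpha}\,|\nu_{i,k,n}|^2,$$ where the $\nu_{i,k,n}$ are complex random variables whose moduli all have the same law, and all $z_k$ and $\nu_{i,k,n}$ are jointly independent. Let $$\mathcal C^*=\mathbb E\Big[\max_{u,q}\ \sum_{i=1}^B\sum_{n=1}^N\log\Big(1+\frac{q_{i,n}\gamma_{i,u_{i,n},n}}{1+\sum_{j\ne i}q_{j,n}\gamma_{j,u_{i,n},n}}\Big)\Big],$$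 the maximum being over all user allocations $u_{i,n}\in\{1,\dots,K\}$ and all powers $q_{i,n}\ge0$ with $\sum_nq_{i,n}\le P$ for every $i$. Then, for large $K/B$, the following scaling laws hold. * If $|\nu_{i,k,n}|$ is Nakagami-$(m,w)$ with $m,w>0$, i.e. has density $\frac{2m^m}{\Gamma(m)w^m}x^{2m-1}e^{-mx^2/w}$ on $x>0$, then $\mathcal C^*=O\big(BN\log\log\frac KB\big)$ and $\mathcal C^*=\Omega\big(B\log\log\frac KB\big)$. * If $|\nu_{i,k,n}|$ is Weibull$(\lambda,t)$ with $\lambda,t>0$, i.e. has density $\frac t\lambda(\frac x\lambda)^{t-1}e^{-(x/\lambda)^t}$ on $x>0$, then $\mathcal C^*=O\big(BN\log\big((\log\frac KB)^{2/t}\big)\big)$ and $\mathcal C^*=\Omega\big(B\log\big((\log\frac KB)^{2/t}\big)\big)$. * If $|\nu_{i,k,n}|$ is LogNormal$(a,\omega)$ with $a\in\mathbb R$, $\omega>0$, i.e. $\log|\nu_{i,k,n}|$ is Gaussian with mean $a$ and variance $\omega$, then $\mathcal C^*=O\big(BN\sqrt{\log\frac KB}\big)$ and $\mathcal C^*=\Omega\big(B\sqrt{\log\frac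 KB}\big)$. Here $\mathcal C^*=O(BN\,g(K/B))$ and $\mathcal C^*=\Omega(B\,g(K/B))$ mean: there are $c_1,c_2>0$ and $\rho_0$, depending only on $\alpha,\beta,r_0,R,P,\kappa_1,\kappa_2$ and the parameters of the fading law, such that for all $B,K,N\ge1$ with $K/B\ge\rho_0$ and every network as above, $\mathcal C^*$ is finite and $c_2\,B\,g(K/B)\le\mathcal C^*\le c_1\,BN\,g(K/B)$. -/

import Mathlib

open MeasureTheory ProbabilityTheory

universe v

noncomputable section

namespace OFDMA

/-! ### The downlink channel

The plane is `ℂ`. There are `B` transmitters (TX, index `i`), `K` users (index `k`) and `N`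
resource blocks (index `n`). -/

/-- Truncated distance `max {r₀, |x - a|}` between a user at `x` and a TX at `a`. -/
def truncDist (r₀ : ℝ) (a x : ℂ) : ℝ := max r₀ ‖x - a‖

/-- Complex channel gain `h_{i,k,n} = β R_{i,k}^{-α} ν_{i,k,n}`. -/
def channelGain (α β r₀ : ℝ) {B K N : ℕ} (a : Fin B → ℂ) (x : Fin K → ℂ)
    (ν : Fin B → Fin K → Fin N → ℂ) (i : Fin B) (k : Fin K) (n : Fin N) : ℂ :=
  ((β * truncDist r₀ (a i) (x k) ^ (-α) : ℝ) : ℂ) * ν i k n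

/-- Channel SNR `γ_{i,k,n} = |h_{i,k,n}|²` (unit-variance noise). -/
def snr (α β r₀ : ℝ) {B K N : ℕ} (a : Fin B → ℂ) (x : Fin K → ℂ)
    (ν : Fin B → Fin K → Fin N → ℂ) (i : Fin B) (k : Fin K) (n : Fin N) : ℝ :=
  ‖channelGain α β r₀ a x ν i k n‖ ^ 2

/-- Feasible power allocations: nonnegative powers, and total power at most `P` for each TX. -/
def feasiblePowers (B N : ℕ) (P : ℝ) : Set (Fin B → Fin N → ℝ) :=
  {q | (∀ i n, 0 ≤ q i n) ∧ ∀ i, ∑ n, q i n ≤ P}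

/-- Sum-rate for SNRs `γ`, when TX `i` serves user `u i n` with power `q i n` on resource block
`n` and interference is treated as noise. -/
def sumRate {B K N : ℕ} (γ : Fin B → Fin K → Fin N → ℝ) (u : Fin B → Fin N → Fin K)
    (q : Fin B → Fin N → ℝ) : ℝ :=
  ∑ i, ∑ n, Real.log (1 + q i n * γ i (u i n) n /
    (1 + ∑ j ∈ Finset.univ.erase i, q j n * γ j (u i n) n))

/-- Maximum achievable sum-rate over all user and feasible power allocations. For `K ≥ 1`,
`P ≥ 0` and nonnegative `γ` the set is nonempty and bounded. -/
def maxSumRate (P : ℝ) {B K N : ℕ} (γ : Fin B → Fin K → Fin N → ℝ) : ℝ :=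
  sSup {c | ∃ u : Fin B → Fin N → Fin K, ∃ q ∈ feasiblePowers B N P, c = sumRate γ u q}

/-- The maximum achievable sum-rate as a random variable, for random user locations `X` and
random fading factors `ν`. -/
def randomMaxSumRate (α β r₀ P : ℝ) {B K N : ℕ} (a : Fin B → ℂ) {Ω : Type*}
    (X : Fin K → Ω → ℂ) (ν : Fin B → Fin K → Fin N → Ω → ℂ) (ω : Ω) : ℝ :=
  maxSumRate P (snr α β r₀ a (fun k => X k ω) (fun i k n => ν i k n ω))

/-- The expected achievable sum-rate `C*`. -/
def expectedSumRate (α β r₀ P : ℝ) {B K N : ℕ} (a : Fin B → ℂ) {Ω : Type*} [MeasurableSpace Ω]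
    (μ : Measure Ω) (X : Fin K → Ω → ℂ) (ν : Fin B → Fin K → Fin N → Ω → ℂ) : ℝ :=
  ∫ ω, randomMaxSumRate α β r₀ P a X ν ω ∂μ

/-! ### Regular extended networks -/

/-- Regular hexagonal grid (every point has six nearest neighbours, at distance `2 R`), with
origin `o` and orientation `θ`. -/
def hexGrid (R : ℝ) (o : ℂ) (θ : ℝ) : Set ℂ :=
  {z | ∃ m n : ℤ, z = o + 2 * (R : ℂ) * Complex.exp (θ * Complex.I) *
    (m + n * Complex.exp (((Real.pi / 3 : ℝ) : ℂ) * Complex.I))}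

/-- `B` transmitters at distinct points of a regular hexagonal grid with neighbour distance `2 R`,
lying in the disc of radius `p - R`, where the network radius `p` is of order `R √B`
with constants `κ₁`, `κ₂`. -/
structure IsRegularExtended (R κ₁ κ₂ p : ℝ) {B : ℕ} (a : Fin B → ℂ) : Prop where
  radius_gt : R < p
  le_radius : κ₁ * (R * Real.sqrt B) ≤ p
  radius_le : p ≤ κ₂ * (R * Real.sqrt B)
  injective : Function.Injective a
  mem_grid : ∃ (o : ℂ) (θ : ℝ), ∀ i, a i ∈ hexGrid R o θ
  norm_le : ∀ i, ‖a i‖ ≤ p - R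

/-- User locations uniform on the disc of radius `p` and fading factors whose moduli have law
`L`, with all the locations and all the fading factors jointly independent. -/
structure IsRandomChannel {Ω : Type*} [MeasurableSpace Ω] (μ : Measure Ω) (p : ℝ) (L : Measure ℝ)
    {B K N : ℕ} (X : Fin K → Ω → ℂ) (ν : Fin B → Fin K → Fin N → Ω → ℂ) : Prop where
  measurable_location : ∀ k, Measurable (X k)
  measurable_fading : ∀ i k n, Measurable (ν i k n)
  uniform_location : ∀ k, pdf.IsUniform (X k) (Metric.closedBall (0 : ℂ) p) μ volume
  fading_law : ∀ i k n, HasLaw (fun ω => ‖ν i k n ω‖) L μ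
  indep : iIndepFun (fun s : Fin K ⊕ (Fin B × Fin K × Fin N) =>
    Sum.elim X (fun q => ν q.1 q.2.1 q.2.2) s) μ

/-! ### Laws of the fading modulus -/

/-- Nakagami law with shape `m` and spread `w`. -/
def nakagami (m w : ℝ) : Measure ℝ :=
  volume.withDensity fun x => ENNReal.ofReal
    (if 0 < x then 2 * m ^ m / (Real.Gamma m * w ^ m) * x ^ (2 * m - 1) *
      Real.exp (-(m / w) * x ^ 2) else 0)

/-- Weibull law with scale `l` and shape `t`. -/
def weibull (l t : ℝ) : Measure ℝ :=
  volume.withDensity fun x => ENNReal.ofReal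
    (if 0 < x then t / l * (x / l) ^ (t - 1) * Real.exp (-(x / l) ^ t) else 0)

/-- Log-normal law: the law of `exp Z` for `Z` Gaussian with mean `a` and variance `v`. -/
def logNormal (a v : ℝ) : Measure ℝ :=
  (gaussianReal a v.toNNReal).map Real.exp

/-! ### Scaling laws -/

/-- In regular extended networks with fading-modulus law `L`, `C*` is (finite and)
`O(B N g(K/B))` and `Ω(B g(K/B))` for large `K/B`. The constants `c₁`, `c₂`, `ρ₀` do not depend
on `B`, `K`, `N`, the placement of the transmitters, the network radius or the probability
space. -/
def HasScalingLaw (α β r₀ R P κ₁ κ₂ : ℝ) (L : Measure ℝ) (g : ℝ → ℝ) : Prop :=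
  ∃ c₁ > 0, ∃ c₂ > 0, ∃ ρ₀ : ℝ,
    ∀ (B K N : ℕ), 1 ≤ B → 1 ≤ K → 1 ≤ N → ρ₀ ≤ (K : ℝ) / B →
    ∀ (p : ℝ) (a : Fin B → ℂ), IsRegularExtended R κ₁ κ₂ p a →
    ∀ (Ω : Type v) [MeasurableSpace Ω] (μ : Measure Ω) [IsProbabilityMeasure μ]
      (X : Fin K → Ω → ℂ) (ν : Fin B → Fin K → Fin N → Ω → ℂ), IsRandomChannel μ p L X ν →
      Integrable (randomMaxSumRate α β r₀ P a X ν) μ ∧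
      expectedSumRate α β r₀ P a μ X ν ≤ c₁ * (B * N * g (K / B)) ∧
      c₂ * (B * g (K / B)) ≤ expectedSumRate α β r₀ P a μ X ν

end OFDMA

end

/-! Write `s = K / B`. For the upper bound, drop the interference and use `log (1 + P y) ≤ log (1 +
P x) + (y / x) 1_{y > x}`. Summing the excess over all users removes the maximum: each pair
(transmitter, block) costs a deterministic logarithm plus an excess term. The attenuation is at most
its value at distance `r₀`, so a large SNR needs fading power above a cutoff `Y`. The attenuation is
integrable over the plane because `2 α > 2`, and the location has density `1 / (π p²)`, so by
independence the mean excess of one user is of order `E[|ν|²; |ν|² > Y] / (Y p²)`. If the truncated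
moment is at most `Y / s`, the `K` users together contribute `O(B / p²) = O(1)` and only `log Y`
remains (`IsRandomChannel.lintegral_randomMaxSumRate_le`).

For the lower bound, each transmitter puts all its power on one block, which is why no factor `N`
appears, and serves a user within `r₀` with fading power above `y` and bounded interference. Since
transmitters are `2 R` apart, their attenuations have a uniformly bounded sum at every point
(`exists_sum_pathGain_le`), so Markov's inequality keeps half of the probability `(r₀² / p²) P(|ν|²
> y)`. This is at least of order `1 / K` when the tail is at least of order `1 / s`. Distinct users
give independent events, so a good user exists with probability bounded below
(`one_sub_exp_le_measureReal_iUnion`), and each transmitter earns order `log y`.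

`HasTailProfile` isolates what the fading law must supply: levels `Y` and `y` whose logarithms match
`g s` from above and below. For Nakagami and Weibull laws both are multiples of `(log s) ^ (2 / t)`,
with `t = 2` for Nakagami; for the log-normal law both are exponentials of multiples of `√(log s)`.
-/

namespace OFDMA

/-! ### Attenuation and SNR. -/

section Network

open Finset
open scoped ENNReal

/-- Squared deterministic attenuation between a transmitter at `a` and a user at `x`. -/
noncomputable def pathGain (α r₀ : ℝ) (a x : ℂ) : ℝ := (truncDist r₀ a x ^ (-α)) ^ 2

lemma truncDist_pos {r₀ : ℝ} (hr₀ : 0 < r₀) (a x : ℂ) : 0 < truncDist r₀ a x :=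
  lt_max_of_lt_left hr₀

lemma pathGain_nonneg (α r₀ : ℝ) (a x : ℂ) : 0 ≤ pathGain α r₀ a x := sq_nonneg _

lemma pathGain_le {α r₀ : ℝ} (hα : 0 < α) (hr₀ : 0 < r₀) (a x : ℂ) :
    pathGain α r₀ a x ≤ (r₀ ^ (-α)) ^ 2 := by
  exact pow_le_pow_left₀ (Real.rpow_nonneg (truncDist_pos hr₀ a x).le _)
    (Real.rpow_le_rpow_of_nonpos hr₀ (le_max_left _ _) (by linarith)) 2

lemma pathGain_eq_of_norm_le {α r₀ : ℝ} {a x : ℂ} (h : ‖x - a‖ ≤ r₀) :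
    pathGain α r₀ a x = (r₀ ^ (-α)) ^ 2 := by
  rw [pathGain, truncDist, max_eq_left h]

lemma measurable_pathGain (α r₀ : ℝ) (a : ℂ) : Measurable (pathGain α r₀ a) := by
  unfold pathGain truncDist
  fun_prop

lemma snr_eq (α β r₀ : ℝ) {B K N : ℕ} (a : Fin B → ℂ) (x : Fin K → ℂ)
    (ν : Fin B → Fin K → Fin N → ℂ) (i : Fin B) (k : Fin K) (n : Fin N) :
    snr α β r₀ a x ν i k n = β ^ 2 * pathGain α r₀ (a i) (x k) * ‖ν i k n‖ ^ 2 := by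
  rw [snr, channelGain, norm_mul, mul_pow, Complex.norm_real, Real.norm_eq_abs, sq_abs, mul_pow,
    pathGain]

lemma snr_nonneg (α β r₀ : ℝ) {B K N : ℕ} (a : Fin B → ℂ) (x : Fin K → ℂ)
    (ν : Fin B → Fin K → Fin N → ℂ) (i : Fin B) (k : Fin K) (n : Fin N) :
    0 ≤ snr α β r₀ a x ν i k n := sq_nonneg _

/-! ### Deterministic bounds on the sum-rate, and its semicontinuity. -/

section SumRate

variable {B K N : ℕ} {P : ℝ}

lemma power_le {q : Fin B → Fin N → ℝ} (hq : q ∈ feasiblePowers B N P) (i : Fin B) (n : Fin N) :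
    q i n ≤ P :=
  (single_le_sum (f := fun n => q i n) (fun m _ => hq.1 i m) (mem_univ n)).trans (hq.2 i)

/-- Excess of the logarithm of a linear quantity over its value at a threshold. -/
lemma log_one_add_mul_le {c x y : ℝ} (hc : 0 ≤ c) (hx : 0 < x) (hy : 0 ≤ y) :
    Real.log (1 + c * y) ≤ Real.log (1 + c * x) + (if x < y then y / x else 0) := by
  have hcx : 0 ≤ c * x := by positivity
  have hcy : 0 ≤ c * y := by positivity
  split_ifs with h
  · have h1 : 1 + c * y ≤ (1 + c * x) * (y / x) := by
      have : 1 ≤ y / x := (one_le_div hx).2 h.le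
      have e : c * x * (y / x) = c * y := by field_simp
      rw [add_mul, e]; linarith
    have hyx : 0 < y / x := by have := hx.trans h; positivity
    calc Real.log (1 + c * y) ≤ Real.log ((1 + c * x) * (y / x)) := Real.log_le_log (by linarith) h1
      _ = Real.log (1 + c * x) + Real.log (y / x) := Real.log_mul (by linarith) hyx.ne'
      _ ≤ _ := by gcongr; exact Real.log_le_self hyx.le
  · rw [add_zero]
    exact Real.log_le_log (by linarith) (by have := not_lt.1 h; gcongr)

/-- Bound on the sum-rate by the SNRs exceeding a threshold. -/
noncomputable def thresholdBound (P x : ℝ) (γ : Fin B → Fin K → Fin N → ℝ) : ℝ :=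
  ∑ i, ∑ n, (Real.log (1 + P * x) + ∑ k, if x < γ i k n then γ i k n / x else 0)

lemma sumRate_le_thresholdBound (hP : 0 ≤ P) {γ : Fin B → Fin K → Fin N → ℝ}
    (hγ : ∀ i k n, 0 ≤ γ i k n) {x : ℝ} (hx : 0 < x) (u : Fin B → Fin N → Fin K)
    {q : Fin B → Fin N → ℝ} (hq : q ∈ feasiblePowers B N P) :
    sumRate γ u q ≤ thresholdBound P x γ := by
  unfold sumRate thresholdBound
  gcongr with i _ n _
  have hI : 0 ≤ ∑ j ∈ univ.erase i, q j n * γ j (u i n) n :=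
    sum_nonneg fun j _ => mul_nonneg (hq.1 j n) (hγ _ _ _)
  have h0 : 0 ≤ q i n * γ i (u i n) n := mul_nonneg (hq.1 i n) (hγ _ _ _)
  calc Real.log (1 + q i n * γ i (u i n) n / (1 + ∑ j ∈ univ.erase i, q j n * γ j (u i n) n))
      ≤ Real.log (1 + P * γ i (u i n) n) := by
        apply Real.log_le_log (by positivity)
        gcongr
        calc _ ≤ q i n * γ i (u i n) n := div_le_self h0 (by linarith)
          _ ≤ _ := mul_le_mul_of_nonneg_right (power_le hq i n) (hγ _ _ _)
    _ ≤ _ := log_one_add_mul_le hP hx (hγ i (u i n) n)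
    _ ≤ _ := by
        gcongr
        -- Only the served user matters, but summing over all users makes the bound independent of
        -- `u`, so it survives the supremum and its mean can be taken termwise.
        exact single_le_sum (f := fun k => if x < γ i k n then γ i k n / x else 0)
          (fun k _ => by split_ifs; exacts [div_nonneg (hγ _ _ _) hx.le, le_rfl])
          (mem_univ (u i n))

lemma bddAbove_sumRate (hP : 0 ≤ P) {γ : Fin B → Fin K → Fin N → ℝ} (hγ : ∀ i k n, 0 ≤ γ i k n) :
    BddAbove {c | ∃ u : Fin B → Fin N → Fin K, ∃ q ∈ feasiblePowers B N P, c = sumRate γ u q} := by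
  refine ⟨thresholdBound P 1 γ, ?_⟩
  rintro _ ⟨u, q, hq, rfl⟩
  exact sumRate_le_thresholdBound hP hγ one_pos u hq

lemma sumRate_le_maxSumRate (hP : 0 ≤ P) {γ : Fin B → Fin K → Fin N → ℝ}
    (hγ : ∀ i k n, 0 ≤ γ i k n) (u : Fin B → Fin N → Fin K)
    {q : Fin B → Fin N → ℝ} (hq : q ∈ feasiblePowers B N P) :
    sumRate γ u q ≤ maxSumRate P γ :=
  le_csSup (bddAbove_sumRate hP hγ) ⟨u, q, hq, rfl⟩

lemma zero_mem_feasiblePowers (hP : 0 ≤ P) : (0 : Fin B → Fin N → ℝ) ∈ feasiblePowers B N P :=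
  ⟨fun _ _ => le_rfl, fun _ => by simpa using hP⟩

lemma maxSumRate_le_thresholdBound [NeZero K] (hP : 0 ≤ P) {γ : Fin B → Fin K → Fin N → ℝ}
    (hγ : ∀ i k n, 0 ≤ γ i k n) {x : ℝ} (hx : 0 < x) :
    maxSumRate P γ ≤ thresholdBound P x γ := by
  refine csSup_le ⟨_, fun _ _ => 0, 0, zero_mem_feasiblePowers hP, rfl⟩ ?_
  rintro _ ⟨u, q, hq, rfl⟩
  exact sumRate_le_thresholdBound hP hγ hx u hq

lemma maxSumRate_nonneg [NeZero K] (hP : 0 ≤ P) {γ : Fin B → Fin K → Fin N → ℝ}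
    (hγ : ∀ i k n, 0 ≤ γ i k n) : 0 ≤ maxSumRate P γ := by
  have h := sumRate_le_maxSumRate hP hγ (fun _ _ => 0) (zero_mem_feasiblePowers (B := B) (N := N) hP)
  simpa [sumRate] using h

/-- If user `k` has a strong signal from TX `i` and weak interference on resource block `n₀`, TX `i`
can achieve the corresponding rate; all transmitters do this simultaneously. -/
lemma sum_log_le_maxSumRate [NeZero K] (hP : 0 ≤ P) {γ : Fin B → Fin K → Fin N → ℝ}
    (hγ : ∀ i k n, 0 ≤ γ i k n) (n₀ : Fin N) {c M : ℝ} (hc : 0 ≤ c) (G : Fin B → Prop)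
    [DecidablePred G]
    (hG : ∀ i, G i → ∃ k, c ≤ P * γ i k n₀ ∧ ∑ j ∈ univ.erase i, P * γ j k n₀ ≤ M) :
    ∑ i, (if G i then Real.log (1 + c / (1 + M)) else 0) ≤ maxSumRate P γ := by
  have hG' : ∀ i, ∃ k, G i → c ≤ P * γ i k n₀ ∧ ∑ j ∈ univ.erase i, P * γ j k n₀ ≤ M := by
    intro i
    by_cases h : G i
    · obtain ⟨k, hk⟩ := hG i h; exact ⟨k, fun _ => hk⟩
    · exact ⟨0, fun h' => (h h').elim⟩
  choose u hu using hG'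
  -- All power goes to the single block `n₀`; the rates on the other blocks are merely nonnegative.
  let q : Fin B → Fin N → ℝ := fun _ n => if n = n₀ then P else 0
  have hq0 : ∀ i n, 0 ≤ q i n := fun i n => by
    show 0 ≤ if n = n₀ then P else 0
    split_ifs; exacts [hP, le_rfl]
  have hq : q ∈ feasiblePowers B N P := ⟨hq0, fun i => by simp [q]⟩
  refine le_trans ?_ (sumRate_le_maxSumRate hP hγ (fun i _ => u i) hq)
  unfold sumRate
  gcongr with i _
  have hI : ∀ n, 0 ≤ ∑ j ∈ univ.erase i, q j n * γ j (u i) n := fun n =>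
    sum_nonneg fun j _ => mul_nonneg (hq0 j n) (hγ _ _ _)
  have hterm : ∀ n, 0 ≤ Real.log (1 + q i n * γ i (u i) n /
      (1 + ∑ j ∈ univ.erase i, q j n * γ j (u i) n)) := fun n => by
    apply Real.log_nonneg
    have := hI n
    have := mul_nonneg (hq0 i n) (hγ i (u i) n)
    have : 0 ≤ q i n * γ i (u i) n / (1 + ∑ j ∈ univ.erase i, q j n * γ j (u i) n) := by positivity
    linarith
  split_ifs with h
  · refine le_trans ?_ (single_le_sum (fun n _ => hterm n) (mem_univ n₀))
    obtain ⟨h1, h2⟩ := hu i h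
    have hI0 := hI n₀
    have e : ∀ j, q j n₀ = P := fun j => if_pos rfl
    simp only [e] at hI0 ⊢
    have hM : 0 ≤ M := hI0.trans h2
    apply Real.log_le_log (by positivity)
    gcongr
    exact hc.trans h1
  · exact sum_nonneg fun n _ => hterm n

/-- A supremum of continuous functions is lower semicontinuous, hence measurable, although the
family of power allocations is uncountable. Truncating at `0` keeps the denominators positive and
the family bounded for every real array; it changes nothing for SNRs. -/
lemma lowerSemicontinuous_maxSumRate [NeZero K] (hP : 0 ≤ P) :
    LowerSemicontinuous fun γ : Fin B → Fin K → Fin N → ℝ =>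
      maxSumRate P fun i k n => max (γ i k n) 0 := by
  have e : (fun γ : Fin B → Fin K → Fin N → ℝ => maxSumRate P fun i k n => max (γ i k n) 0) =
      fun γ => ⨆ s : (Fin B → Fin N → Fin K) × feasiblePowers B N P,
        sumRate (fun i k n => max (γ i k n) 0) s.1 s.2 := by
    funext γ
    rw [maxSumRate, iSup]
    congr 1
    ext c
    constructor
    · rintro ⟨u, q, hq, rfl⟩
      exact ⟨(u, ⟨q, hq⟩), rfl⟩
    · rintro ⟨⟨u, q, hq⟩, rfl⟩
      exact ⟨u, q, hq, rfl⟩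
  rw [e]
  refine lowerSemicontinuous_ciSup (fun γ => ?_) (fun s => ?_)
  · obtain ⟨b, hb⟩ := bddAbove_sumRate (γ := fun i k n => max (γ i k n) 0) hP
      (fun _ _ _ => le_max_right _ _)
    refine ⟨b, ?_⟩
    rintro _ ⟨⟨u, q, hq⟩, rfl⟩
    exact hb ⟨u, q, hq, rfl⟩
  · apply Continuous.lowerSemicontinuous
    obtain ⟨u, q, hq⟩ := s
    unfold sumRate
    refine continuous_finsetSum _ fun i _ => continuous_finsetSum _ fun n _ => ?_
    have hI : ∀ γ : Fin B → Fin K → Fin N → ℝ,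
        0 ≤ ∑ j ∈ univ.erase i, q j n * max (γ j (u i n) n) 0 := fun γ =>
      sum_nonneg fun j _ => mul_nonneg (hq.1 j n) (le_max_right _ _)
    have h0 : ∀ γ : Fin B → Fin K → Fin N → ℝ, 0 ≤ q i n * max (γ i (u i n) n) 0 := fun γ =>
      mul_nonneg (hq.1 i n) (le_max_right _ _)
    refine Continuous.log ?_ fun γ => ?_
    · refine continuous_const.add (Continuous.div (by fun_prop) (by fun_prop) fun γ => ?_)
      have := hI γ
      positivity
    · have := hI γ
      have := h0 γ
      positivity

end SumRate

/-! ### Measurability of the random sum-rate. -/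

lemma measurable_snr {α β r₀ : ℝ} {B K N : ℕ} (a : Fin B → ℂ)
    {Ω : Type*} [MeasurableSpace Ω] {X : Fin K → Ω → ℂ} {ν : Fin B → Fin K → Fin N → Ω → ℂ}
    (hX : ∀ k, Measurable (X k)) (hν : ∀ i k n, Measurable (ν i k n))
    (i : Fin B) (k : Fin K) (n : Fin N) :
    Measurable fun ω => snr α β r₀ a (fun k => X k ω) (fun i k n => ν i k n ω) i k n := by
  simp only [snr_eq]
  exact (((measurable_pathGain α r₀ (a i)).comp (hX k)).const_mul _).mul
    ((hν i k n).norm.pow_const 2)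

lemma measurable_randomMaxSumRate {α β r₀ P : ℝ} (hP : 0 ≤ P) {B K N : ℕ} [NeZero K]
    (a : Fin B → ℂ)
    {Ω : Type*} [MeasurableSpace Ω] {X : Fin K → Ω → ℂ} {ν : Fin B → Fin K → Fin N → Ω → ℂ}
    (hX : ∀ k, Measurable (X k)) (hν : ∀ i k n, Measurable (ν i k n)) :
    Measurable (randomMaxSumRate α β r₀ P a X ν) := by
  have h := (lowerSemicontinuous_maxSumRate (B := B) (K := K) (N := N) hP).measurable.comp
    (measurable_pi_lambda _ fun i => measurable_pi_lambda _ fun k => measurable_pi_lambda _ fun n =>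
      measurable_snr (α := α) (β := β) (r₀ := r₀) a hX hν i k n)
  convert h using 1
  funext ω
  simp only [randomMaxSumRate, Function.comp]
  congr 1
  funext i k n
  exact (max_eq_left (snr_nonneg _ _ _ _ _ _ _ _ _)).symm

/-! ### Integrability of the attenuation and the packing bound. -/

/-- Integral over the plane of the squared attenuation. -/
noncomputable def totalGain (α r₀ : ℝ) : ℝ≥0∞ := ∫⁻ z : ℂ, ENNReal.ofReal (pathGain α r₀ 0 z)

lemma lintegral_pathGain (α r₀ : ℝ) (a : ℂ) :
    ∫⁻ z : ℂ, ENNReal.ofReal (pathGain α r₀ a z) = totalGain α r₀ := by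
  rw [totalGain, ← lintegral_sub_right_eq_self (fun z => ENNReal.ofReal (pathGain α r₀ 0 z)) a]
  simp [pathGain, truncDist]

/-- A larger distance lowers the gain by at most the corresponding power. -/
lemma pathGain_le_mul_of_truncDist_le {α r₀ c : ℝ} (hα : 0 < α) (hr₀ : 0 < r₀) (hc : 0 < c)
    {a b x y : ℂ} (h : truncDist r₀ b y ≤ c * truncDist r₀ a x) :
    pathGain α r₀ a x ≤ (c ^ α) ^ 2 * pathGain α r₀ b y := by
  have ha := truncDist_pos hr₀ a x
  have hb := truncDist_pos hr₀ b y
  rw [pathGain, pathGain, ← mul_pow]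
  refine pow_le_pow_left₀ (Real.rpow_nonneg ha.le _) ?_ 2
  calc truncDist r₀ a x ^ (-α) = c ^ α * (c * truncDist r₀ a x) ^ (-α) := by
        rw [Real.mul_rpow hc.le ha.le, ← mul_assoc, ← Real.rpow_add hc]; simp
    _ ≤ _ := by
        refine mul_le_mul_of_nonneg_left ?_ (Real.rpow_nonneg hc.le _)
        exact Real.rpow_le_rpow_of_nonpos hb h (by linarith)

/-- The gain decays like `‖z‖ ^ (-2 α)`, which is integrable in dimension two exactly because `α >
1`. -/
lemma totalGain_lt_top {α r₀ : ℝ} (hα : 1 < α) (hr₀ : 0 < r₀) : totalGain α r₀ < ∞ := by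
  have hfin : ∫⁻ z : ℂ, ENNReal.ofReal ((1 + ‖z‖) ^ (-(2 * α))) < ∞ :=
    finite_integral_one_add_norm (by rw [Complex.finrank_real_complex]; push_cast; linarith)
  have hc : 0 < r₀ / (1 + r₀) := by positivity
  have hle : ∀ z : ℂ, pathGain α r₀ 0 z ≤
      ((r₀ / (1 + r₀)) ^ (-α)) ^ 2 * (1 + ‖z‖) ^ (-(2 * α)) := by
    intro z
    -- The truncated distance dominates both `r₀` and `‖z‖`; add the first bound to `r₀` times the
    -- second.
    have h1 : r₀ / (1 + r₀) * (1 + ‖z‖) ≤ truncDist r₀ 0 z := by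
      have a1 : r₀ ≤ truncDist r₀ 0 z := le_max_left _ _
      have a2 : ‖z‖ ≤ truncDist r₀ 0 z := by rw [truncDist, sub_zero]; exact le_max_right _ _
      rw [div_mul_eq_mul_div, div_le_iff₀ (by linarith)]
      nlinarith
    have hz : 0 < 1 + ‖z‖ := by positivity
    calc pathGain α r₀ 0 z ≤ ((r₀ / (1 + r₀) * (1 + ‖z‖)) ^ (-α)) ^ 2 :=
          pow_le_pow_left₀ (Real.rpow_nonneg (truncDist_pos hr₀ _ _).le _)
            (Real.rpow_le_rpow_of_nonpos (by positivity) h1 (by linarith)) 2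
      _ = _ := by
          rw [Real.mul_rpow hc.le hz.le, mul_pow, ← Real.rpow_natCast ((1 + ‖z‖) ^ (-α)),
            ← Real.rpow_mul hz.le]
          congr 2; push_cast; ring
  calc totalGain α r₀
      ≤ ∫⁻ z : ℂ, ENNReal.ofReal (((r₀ / (1 + r₀)) ^ (-α)) ^ 2) *
          ENNReal.ofReal ((1 + ‖z‖) ^ (-(2 * α))) := by
        refine lintegral_mono fun z => ?_
        rw [← ENNReal.ofReal_mul (sq_nonneg _)]
        exact ENNReal.ofReal_le_ofReal (hle z)
    _ = ENNReal.ofReal (((r₀ / (1 + r₀)) ^ (-α)) ^ 2) *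
          ∫⁻ z : ℂ, ENNReal.ofReal ((1 + ‖z‖) ^ (-(2 * α))) := lintegral_const_mul' _ _ (by simp)
    _ < ∞ := ENNReal.mul_lt_top (by simp) hfin

/-- The total gain from points at mutual distance at least `2 R` is bounded uniformly. -/
lemma exists_sum_pathGain_le {α r₀ R : ℝ} (hα : 1 < α) (hr₀ : 0 < r₀) (hR : 0 < R) :
    ∃ S : ℝ, 0 < S ∧ ∀ {ι : Type} [Fintype ι] (a : ι → ℂ),
      (∀ i j, i ≠ j → 2 * R ≤ dist (a i) (a j)) → ∀ z, ∑ j, pathGain α r₀ (a j) z ≤ S := by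
  have hα0 : 0 < α := by linarith
  have hv : ∀ b : ℂ, volume (Metric.ball b R) = ENNReal.ofReal (Real.pi * R ^ 2) := by
    intro b
    rw [Complex.volume_ball, mul_comm, ENNReal.ofReal_mul Real.pi_pos.le, ENNReal.ofReal_pow hR.le]
    congr 1
    exact (ENNReal.ofReal_coe_nnreal (p := NNReal.pi)).symm
  set C : ℝ := ((1 + R / r₀) ^ α) ^ 2 with hC
  have hA : 0 < Real.pi * R ^ 2 := by positivity
  -- The extra `1` gives positivity without a lower bound on `totalGain`.
  refine ⟨C * (totalGain α r₀).toReal / (Real.pi * R ^ 2) + 1, by positivity, ?_⟩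
  intro ι _ a ha z
  -- Each gain is compared with its values on a ball around the transmitter, with the roles
  -- exchanged: `z` becomes the fixed centre. The balls are disjoint, so the sum is controlled by
  -- one integral over the plane.
  have hlocal : ∀ j, ∀ w ∈ Metric.ball (a j) R, pathGain α r₀ (a j) z ≤ C * pathGain α r₀ z w := by
    intro j w hw
    refine pathGain_le_mul_of_truncDist_le hα0 hr₀ (by positivity) ?_
    have h1 : ‖w - a j‖ < R := by simpa [dist_eq_norm] using hw
    have h2 : ‖w - z‖ ≤ ‖w - a j‖ + ‖z - a j‖ := by
      have := norm_sub_le (w - a j) (z - a j)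
      simpa using this
    have a1 : r₀ ≤ truncDist r₀ (a j) z := le_max_left _ _
    have a2 : ‖z - a j‖ ≤ truncDist r₀ (a j) z := le_max_right _ _
    have a3 : R ≤ R / r₀ * truncDist r₀ (a j) z := by
      rw [div_mul_eq_mul_div, le_div_iff₀ hr₀]; gcongr
    rw [add_mul, one_mul]
    exact max_le (by linarith) (by linarith)
  have hdisj : Pairwise (Function.onFun Disjoint fun j => Metric.ball (a j) R) := fun i j hij =>
    Metric.ball_disjoint_ball (by linarith [ha i j hij])
  have key : ENNReal.ofReal (∑ j, pathGain α r₀ (a j) z) * ENNReal.ofReal (Real.pi * R ^ 2) ≤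
      ENNReal.ofReal C * totalGain α r₀ := by
    rw [ENNReal.ofReal_sum_of_nonneg fun j _ => pathGain_nonneg _ _ _ _, Finset.sum_mul]
    calc ∑ j, ENNReal.ofReal (pathGain α r₀ (a j) z) * ENNReal.ofReal (Real.pi * R ^ 2)
        = ∑ j, ∫⁻ _ in Metric.ball (a j) R, ENNReal.ofReal (pathGain α r₀ (a j) z) := by
          simp [hv]
      _ ≤ ∑ j, ∫⁻ w in Metric.ball (a j) R, ENNReal.ofReal (C * pathGain α r₀ z w) := by
          refine sum_le_sum fun j _ => ?_
          exact setLIntegral_mono' Metric.isOpen_ball.measurableSet fun w hw =>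
            ENNReal.ofReal_le_ofReal (hlocal j w hw)
      _ = ∫⁻ w in ⋃ j, Metric.ball (a j) R, ENNReal.ofReal (C * pathGain α r₀ z w) := by
          rw [lintegral_iUnion (fun j => Metric.isOpen_ball.measurableSet) hdisj, tsum_fintype]
      _ ≤ ∫⁻ w, ENNReal.ofReal (C * pathGain α r₀ z w) := setLIntegral_le_lintegral _ _
      _ = ENNReal.ofReal C * totalGain α r₀ := by
          have hC0 : 0 ≤ C := sq_nonneg _
          simp only [ENNReal.ofReal_mul hC0]
          rw [lintegral_const_mul' _ _ (by simp), lintegral_pathGain]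
  rw [← ENNReal.ofReal_mul (sum_nonneg fun j _ => pathGain_nonneg _ _ _ _),
    ← ENNReal.ofReal_toReal (totalGain_lt_top hα hr₀).ne, ← ENNReal.ofReal_mul (sq_nonneg _),
    ENNReal.ofReal_le_ofReal_iff (by positivity), ← le_div_iff₀ hA] at key
  linarith

/-! ### Uniform user locations. -/

section Uniform

variable {Ω : Type*} [MeasurableSpace Ω] {μ : Measure Ω} {X : Ω → ℂ} {p : ℝ}

lemma volume_closedBall_eq (b : ℂ) {r : ℝ} (hr : 0 ≤ r) :
    volume (Metric.closedBall b r) = ENNReal.ofReal (Real.pi * r ^ 2) := by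
  rw [Complex.volume_closedBall, mul_comm, ENNReal.ofReal_mul Real.pi_pos.le,
    ENNReal.ofReal_pow hr]
  congr 1
  exact (ENNReal.ofReal_coe_nnreal (p := NNReal.pi)).symm

lemma lintegral_pathGain_uniform_le (hX : Measurable X) (hp : 0 < p)
    (hU : pdf.IsUniform X (Metric.closedBall (0 : ℂ) p) μ volume) (α r₀ : ℝ) (a : ℂ) :
    ∫⁻ ω, ENNReal.ofReal (pathGain α r₀ a (X ω)) ∂μ ≤
      (ENNReal.ofReal (Real.pi * p ^ 2))⁻¹ * totalGain α r₀ := by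
  have hm : Measurable fun z => ENNReal.ofReal (pathGain α r₀ a z) :=
    (measurable_pathGain α r₀ a).ennreal_ofReal
  rw [← lintegral_map hm hX, hU, ProbabilityTheory.cond, lintegral_smul_measure,
    volume_closedBall_eq _ hp.le, smul_eq_mul, ← lintegral_pathGain α r₀ a]
  exact mul_le_mul_right (setLIntegral_le_lintegral _ _) _

lemma measure_norm_sub_le_uniform (hX : Measurable X) (hp : 0 < p)
    (hU : pdf.IsUniform X (Metric.closedBall (0 : ℂ) p) μ volume) {a : ℂ} {r : ℝ} (hr : 0 ≤ r)
    (ha : ‖a‖ + r ≤ p) :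
    μ {ω | ‖X ω - a‖ ≤ r} = ENNReal.ofReal (r ^ 2 / p ^ 2) := by
  have hs : {ω | ‖X ω - a‖ ≤ r} = X ⁻¹' Metric.closedBall a r := by
    ext ω; simp [dist_eq_norm]
  have hsub : Metric.closedBall a r ⊆ Metric.closedBall 0 p := by
    apply Metric.closedBall_subset_closedBall'
    rw [dist_zero_right]; linarith
  rw [hs, ← Measure.map_apply hX Metric.isClosed_closedBall.measurableSet, hU,
    cond_apply Metric.isClosed_closedBall.measurableSet, Set.inter_eq_self_of_subset_right hsub,
    volume_closedBall_eq _ hp.le, volume_closedBall_eq _ hr,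
    ← ENNReal.ofReal_inv_of_pos (by positivity), ← ENNReal.ofReal_mul (by positivity)]
  congr 1
  field_simp

end Uniform

/-- In lattice coordinates the squared distance is `4 R²` times the form `k² + k l + l²`, which is
integral and positive definite, hence at least `1` off the origin. -/
lemma dist_hexGrid {R θ : ℝ} {o z w : ℂ} (hR : 0 < R) (hz : z ∈ hexGrid R o θ)
    (hw : w ∈ hexGrid R o θ) (hzw : z ≠ w) : 2 * R ≤ dist z w := by
  obtain ⟨m, n, rfl⟩ := hz
  obtain ⟨m', n', rfl⟩ := hw
  have e : ∀ E F : ℂ, o + 2 * (R : ℂ) * E * (m + n * F) - (o + 2 * (R : ℂ) * E * (m' + n' * F)) =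
      ((2 * R : ℝ) : ℂ) * (E * (((m - m' : ℤ) : ℂ) + ((n - n' : ℤ) : ℂ) * F)) := by
    intro E F; push_cast; ring
  have hne : ¬ (m - m' = 0 ∧ n - n' = 0) := by
    rintro ⟨h1, h2⟩
    apply hzw
    rw [sub_eq_zero.1 h1, sub_eq_zero.1 h2]
  rw [dist_eq_norm, e, norm_mul, norm_mul, Complex.norm_exp_ofReal_mul_I, one_mul, Complex.norm_real,
    Real.norm_eq_abs, abs_of_pos (by linarith)]
  refine le_mul_of_one_le_right (by linarith) ?_
  generalize m - m' = k at hne ⊢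
  generalize n - n' = l at hne ⊢
  have hkl : (1 : ℤ) ≤ k ^ 2 + k * l + l ^ 2 := by
    by_contra h
    have h0 : k ^ 2 + k * l + l ^ 2 ≤ 0 := by omega
    have hk : k = 0 := by
      -- This rests on `4 (k² + k l + l²) = 3 k² + (k + 2 l)²`.
      have : k ^ 2 ≤ 0 := by nlinarith [sq_nonneg (k + l), sq_nonneg (k + 2 * l)]
      exact pow_eq_zero_iff two_ne_zero |>.1 (le_antisymm this (sq_nonneg _))
    have hl : l = 0 := by
      have : l ^ 2 ≤ 0 := by nlinarith [sq_nonneg (k + l), sq_nonneg (2 * k + l)]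
      exact pow_eq_zero_iff two_ne_zero |>.1 (le_antisymm this (sq_nonneg _))
    exact hne ⟨hk, hl⟩
  have hsq : ‖(k : ℂ) + (l : ℂ) * Complex.exp (((Real.pi / 3 : ℝ) : ℂ) * Complex.I)‖ ^ 2 =
      (k : ℝ) ^ 2 + k * l + l ^ 2 := by
    have hre := Complex.exp_ofReal_mul_I_re (Real.pi / 3)
    have him := Complex.exp_ofReal_mul_I_im (Real.pi / 3)
    rw [Real.cos_pi_div_three] at hre
    rw [Real.sin_pi_div_three] at him
    rw [Complex.sq_norm, Complex.normSq_apply]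
    simp only [Complex.add_re, Complex.add_im, Complex.mul_re, Complex.mul_im, hre, him,
      Complex.intCast_re, Complex.intCast_im]
    have h3 : Real.sqrt 3 * Real.sqrt 3 = 3 := Real.mul_self_sqrt (by norm_num)
    linear_combination (l : ℝ) ^ 2 / 4 * h3
  have : (1 : ℝ) ≤ (k : ℝ) ^ 2 + k * l + l ^ 2 := by exact_mod_cast hkl
  rw [← hsq] at this
  exact (one_le_sq_iff₀ (norm_nonneg _)).1 this

/-! ### Upper bound on the mean sum-rate. -/

section Upper

variable {Ω : Type*} [MeasurableSpace Ω] {μ : Measure Ω} {p : ℝ} {L : Measure ℝ} {B K N : ℕ}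
  {X : Fin K → Ω → ℂ} {ν : Fin B → Fin K → Fin N → Ω → ℂ}

lemma IsRandomChannel.indepFun_location_fading (h : IsRandomChannel μ p L X ν) (i : Fin B)
    (k k' : Fin K) (n : Fin N) : IndepFun (X k) (ν i k' n) μ :=
  h.indep.indepFun (i := Sum.inl k) (j := Sum.inr (i, k', n)) (by simp)

lemma IsRandomChannel.lintegral_fading (h : IsRandomChannel μ p L X ν) (i : Fin B) (k : Fin K)
    (n : Fin N) {f : ℝ → ℝ≥0∞} (hf : Measurable f) :
    ∫⁻ ω, f ‖ν i k n ω‖ ∂μ = ∫⁻ x, f x ∂L := by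
  rw [← (h.fading_law i k n).map_eq, lintegral_map hf (h.measurable_fading i k n).norm]

/-- Mean excess of one SNR over a threshold. -/
lemma IsRandomChannel.lintegral_snr_excess_le (h : IsRandomChannel μ p L X ν) (hp : 0 < p)
    {α β r₀ : ℝ} (hα : 0 < α) (hβ : 0 < β) (hr₀ : 0 < r₀) {Y : ℝ} (hY : 0 < Y)
    (a : Fin B → ℂ) (i : Fin B) (k : Fin K) (n : Fin N) :
    ∫⁻ ω, ENNReal.ofReal (if β ^ 2 * (r₀ ^ (-α)) ^ 2 * Y <
        snr α β r₀ a (fun k => X k ω) (fun i k n => ν i k n ω) i k n then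
        snr α β r₀ a (fun k => X k ω) (fun i k n => ν i k n ω) i k n /
          (β ^ 2 * (r₀ ^ (-α)) ^ 2 * Y) else 0) ∂μ ≤
      ENNReal.ofReal (1 / ((r₀ ^ (-α)) ^ 2 * Y)) *
        ((ENNReal.ofReal (Real.pi * p ^ 2))⁻¹ * totalGain α r₀ *
          ∫⁻ x in {x | Y < x ^ 2}, ENNReal.ofReal (x ^ 2) ∂L) := by
  have hr : 0 < (r₀ ^ (-α)) ^ 2 := pow_pos (Real.rpow_pos_of_pos hr₀ _) 2
  have hms : MeasurableSet {x : ℝ | Y < x ^ 2} :=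
    measurableSet_lt measurable_const (measurable_id.pow_const 2)
  have hmf : Measurable ({x : ℝ | Y < x ^ 2}.indicator fun x => ENNReal.ofReal (x ^ 2)) :=
    (measurable_id.pow_const 2).ennreal_ofReal.indicator hms
  have hmg : Measurable fun z => ENNReal.ofReal (pathGain α r₀ (a i) z) :=
    (measurable_pathGain α r₀ (a i)).ennreal_ofReal
  have hind := (h.indepFun_location_fading i k k n).comp hmg (hmf.comp measurable_norm)
  calc _ ≤ ∫⁻ ω, ENNReal.ofReal (1 / ((r₀ ^ (-α)) ^ 2 * Y)) *
        (ENNReal.ofReal (pathGain α r₀ (a i) (X k ω)) *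
          {x : ℝ | Y < x ^ 2}.indicator (fun x => ENNReal.ofReal (x ^ 2)) ‖ν i k n ω‖) ∂μ := by
        refine lintegral_mono fun ω => ?_
        simp only [snr_eq]
        split_ifs with hlt
        -- An SNR excess forces a fading excess, since the attenuation is at most its value at
        -- distance `r₀`. The indicator then involves the fading alone, so location and fading
        -- factor.
        · have hmem : ‖ν i k n ω‖ ∈ {x : ℝ | Y < x ^ 2} := by
            have h1 : β ^ 2 * pathGain α r₀ (a i) (X k ω) * ‖ν i k n ω‖ ^ 2 ≤
                β ^ 2 * (r₀ ^ (-α)) ^ 2 * ‖ν i k n ω‖ ^ 2 := by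
              gcongr
              exact pathGain_le hα hr₀ _ _
            exact lt_of_mul_lt_mul_left (hlt.trans_le h1) (by positivity)
          rw [Set.indicator_of_mem hmem, ← ENNReal.ofReal_mul (pathGain_nonneg _ _ _ _),
            ← ENNReal.ofReal_mul (by positivity)]
          apply le_of_eq
          congr 1
          field_simp
        · simp
    _ = ENNReal.ofReal (1 / ((r₀ ^ (-α)) ^ 2 * Y)) *
        ((∫⁻ ω, ENNReal.ofReal (pathGain α r₀ (a i) (X k ω)) ∂μ) *
          ∫⁻ x in {x | Y < x ^ 2}, ENNReal.ofReal (x ^ 2) ∂L) := by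
        have e := lintegral_mul_eq_lintegral_mul_lintegral_of_indepFun
          (hmg.comp (h.measurable_location k))
          ((hmf.comp measurable_norm).comp (h.measurable_fading i k n)) hind
        simp only [Pi.mul_apply, Function.comp] at e
        rw [lintegral_const_mul' _ _ (by simp), e, h.lintegral_fading i k n hmf,
          lintegral_indicator hms]
    _ ≤ _ := by
        gcongr
        exact lintegral_pathGain_uniform_le (h.measurable_location k) hp (h.uniform_location k) _ _ _

/-- Upper bound on the mean of the maximal sum-rate by the threshold `Y` for the fading power. -/
lemma IsRandomChannel.lintegral_randomMaxSumRate_le [NeZero K] [IsProbabilityMeasure μ]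
    (h : IsRandomChannel μ p L X ν)
    {α β r₀ P κ : ℝ} (hα : 1 < α) (hβ : 0 < β) (hr₀ : 0 < r₀) (hP : 0 < P) (hκ : 0 < κ)
    (hB : 1 ≤ B) (hp : 0 < p) (hpB : κ ^ 2 * B ≤ p ^ 2) {Y : ℝ} (hY : 0 < Y)
    (hL : ∫⁻ x in {x | Y < x ^ 2}, ENNReal.ofReal (x ^ 2) ∂L ≤ ENNReal.ofReal (Y / (K / B)))
    (a : Fin B → ℂ) :
    ∫⁻ ω, ENNReal.ofReal (randomMaxSumRate α β r₀ P a X ν ω) ∂μ ≤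
      ENNReal.ofReal (B * N * (Real.log (1 + P * (β ^ 2 * (r₀ ^ (-α)) ^ 2) * Y) +
        (totalGain α r₀).toReal / (Real.pi * κ ^ 2 * (r₀ ^ (-α)) ^ 2))) := by
  have hα0 : 0 < α := by linarith
  have hr : 0 < (r₀ ^ (-α)) ^ 2 := pow_pos (Real.rpow_pos_of_pos hr₀ _) 2
  set x₀ := β ^ 2 * (r₀ ^ (-α)) ^ 2 * Y with hx₀
  have hx : 0 < x₀ := by positivity
  have hBpos : (0 : ℝ) < B := by exact_mod_cast hB
  have hKpos : (0 : ℝ) < K := by exact_mod_cast Nat.pos_of_ne_zero (NeZero.ne K)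
  have hlog : 0 ≤ Real.log (1 + P * x₀) := Real.log_nonneg (by have := mul_pos hP hx; linarith)
  set T := (totalGain α r₀).toReal with hT
  have hT0 : 0 ≤ T := ENNReal.toReal_nonneg
  have hTe : totalGain α r₀ = ENNReal.ofReal T :=
    (ENNReal.ofReal_toReal (totalGain_lt_top hα hr₀).ne).symm
  let f : Fin B → Fin N → Fin K → Ω → ℝ := fun i n k ω => if x₀ <
        snr α β r₀ a (fun k => X k ω) (fun i k n => ν i k n ω) i k n then
        snr α β r₀ a (fun k => X k ω) (fun i k n => ν i k n ω) i k n / x₀ else 0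
  have hf0 : ∀ i n k ω, 0 ≤ f i n k ω := fun i n k ω => by
    show 0 ≤ ite _ _ _
    split_ifs
    exacts [div_nonneg (snr_nonneg _ _ _ _ _ _ _ _ _) hx.le, le_rfl]
  have hfm : ∀ i n k, Measurable (f i n k) := fun i n k => by
    have hm := measurable_snr (α := α) (β := β) (r₀ := r₀) a h.measurable_location
      h.measurable_fading i k n
    exact Measurable.ite (measurableSet_lt measurable_const hm) (hm.div_const _) measurable_const
  have hfi : ∀ i n k, ∫⁻ ω, ENNReal.ofReal (f i n k ω) ∂μ ≤
      ENNReal.ofReal (T / (Real.pi * κ ^ 2 * (r₀ ^ (-α)) ^ 2) / K) := by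
    intro i n k
    refine (h.lintegral_snr_excess_le hp hα0 hβ hr₀ hY a i k n).trans ?_
    calc _ ≤ ENNReal.ofReal (1 / ((r₀ ^ (-α)) ^ 2 * Y)) *
        ((ENNReal.ofReal (Real.pi * p ^ 2))⁻¹ * totalGain α r₀ *
          ENNReal.ofReal (Y / (K / B))) := by gcongr
      _ = ENNReal.ofReal (1 / ((r₀ ^ (-α)) ^ 2 * Y) * ((Real.pi * p ^ 2)⁻¹ * T * (Y / (K / B)))) := by
          rw [hTe, ← ENNReal.ofReal_inv_of_pos (by positivity), ← ENNReal.ofReal_mul (by positivity),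
            ← ENNReal.ofReal_mul (by positivity), ← ENNReal.ofReal_mul (by positivity)]
      _ ≤ _ := by
          apply ENNReal.ofReal_le_ofReal
          -- `Y` cancels, and `B` combines with `p²` into a ratio bounded below by `κ²`. The
          -- remaining `1 / K` is cancelled by the sum over users.
          have e : 1 / ((r₀ ^ (-α)) ^ 2 * Y) * ((Real.pi * p ^ 2)⁻¹ * T * (Y / (K / B))) =
              T / (Real.pi * (p ^ 2 / B) * (r₀ ^ (-α)) ^ 2) / K := by field_simp
          rw [e]
          have : κ ^ 2 ≤ p ^ 2 / B := by rwa [le_div_iff₀ hBpos]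
          gcongr
  calc _ ≤ ∫⁻ ω, ∑ i : Fin B, ∑ n : Fin N, (ENNReal.ofReal (Real.log (1 + P * x₀)) +
        ∑ k, ENNReal.ofReal (f i n k ω)) ∂μ := by
        refine lintegral_mono fun ω => ?_
        have hb := maxSumRate_le_thresholdBound (P := P) hP.le
          (fun i k n => snr_nonneg α β r₀ a (fun k => X k ω) (fun i k n => ν i k n ω) i k n) hx
        refine (ENNReal.ofReal_le_ofReal hb).trans ?_
        have hs : ∀ i n, 0 ≤ ∑ k, f i n k ω := fun i n => sum_nonneg fun k _ => hf0 i n k ω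
        unfold thresholdBound
        change ENNReal.ofReal (∑ i, ∑ n, (Real.log (1 + P * x₀) + ∑ k, f i n k ω)) ≤ _
        rw [ENNReal.ofReal_sum_of_nonneg fun i _ => sum_nonneg fun n _ => add_nonneg hlog (hs i n)]
        refine sum_le_sum fun i _ => ?_
        rw [ENNReal.ofReal_sum_of_nonneg fun n _ => add_nonneg hlog (hs i n)]
        refine sum_le_sum fun n _ => ?_
        rw [ENNReal.ofReal_add hlog (hs i n), ENNReal.ofReal_sum_of_nonneg fun k _ => hf0 i n k ω]
    _ = ∑ i : Fin B, ∑ n : Fin N, (ENNReal.ofReal (Real.log (1 + P * x₀)) +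
        ∑ k, ∫⁻ ω, ENNReal.ofReal (f i n k ω) ∂μ) := by
        have hm1 : ∀ i n, Measurable fun ω => ∑ k, ENNReal.ofReal (f i n k ω) := fun i n =>
          Finset.measurable_fun_sum _ fun k _ => (hfm i n k).ennreal_ofReal
        rw [lintegral_finsetSum _ fun i _ => Finset.measurable_fun_sum _ fun n _ =>
          (hm1 i n).const_add _]
        refine sum_congr rfl fun i _ => ?_
        rw [lintegral_finsetSum _ fun n _ => (hm1 i n).const_add _]
        refine sum_congr rfl fun n _ => ?_
        rw [lintegral_add_left measurable_const, lintegral_finsetSum _ fun k _ =>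
          (hfm i n k).ennreal_ofReal]
        simp
    _ ≤ ∑ i : Fin B, ∑ n : Fin N, (ENNReal.ofReal (Real.log (1 + P * x₀)) +
        ∑ k : Fin K, ENNReal.ofReal (T / (Real.pi * κ ^ 2 * (r₀ ^ (-α)) ^ 2) / K)) := by
        gcongr with i _ n _ k _
        exact hfi i n k
    _ = _ := by
        have e : P * (β ^ 2 * (r₀ ^ (-α)) ^ 2) * Y = P * x₀ := by rw [hx₀]; ring
        rw [e]
        simp only [sum_const, card_univ, Fintype.card_fin, nsmul_eq_mul]
        have hK : (K : ℝ≥0∞) * ENNReal.ofReal (T / (Real.pi * κ ^ 2 * (r₀ ^ (-α)) ^ 2) / K) =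
            ENNReal.ofReal (T / (Real.pi * κ ^ 2 * (r₀ ^ (-α)) ^ 2)) := by
          rw [← ENNReal.ofReal_natCast K, ← ENNReal.ofReal_mul hKpos.le]
          congr 1
          field_simp
        rw [hK, ENNReal.ofReal_mul (by positivity : (0 : ℝ) ≤ B * N), ENNReal.ofReal_mul hBpos.le,
          ENNReal.ofReal_natCast, ENNReal.ofReal_natCast, ENNReal.ofReal_add hlog (by positivity),
          mul_assoc (B : ℝ≥0∞)]

end Upper

/-! ### Independence across users. -/

/-- Events depending on disjoint blocks of independent σ-algebras are independent. -/
lemma measure_biInter_of_iIndep {Ω ι κ : Type*} [mΩ : MeasurableSpace Ω] {μ : Measure Ω}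
    [IsProbabilityMeasure μ] {m : ι → MeasurableSpace Ω} (hm : iIndep m μ) (hle : ∀ i, m i ≤ mΩ)
    {S : κ → Set ι} (hS : Pairwise (Function.onFun Disjoint S)) {E : κ → Set Ω}
    (hE : ∀ k, MeasurableSet[⨆ i ∈ S k, m i] (E k)) (s : Finset κ) :
    μ (⋂ k ∈ s, E k) = ∏ k ∈ s, μ (E k) := by
  classical
  induction s using Finset.induction_on with
  | empty => simp
  | insert k s hk ih =>
    rw [Finset.set_biInter_insert, prod_insert hk, ← ih]
    have hdisj : Disjoint (S k) (⋃ l ∈ s, S l) := by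
      rw [Set.disjoint_iUnion₂_right]
      intro l hl
      exact hS (by rintro rfl; exact hk hl)
    refine (Indep_iff _ _ μ).1 (indep_iSup_of_disjoint hle hm hdisj) _ _ (hE k) ?_
    refine MeasurableSet.biInter s.countable_toSet fun l hl => ?_
    have hsub : (⨆ i ∈ S l, m i) ≤ ⨆ i ∈ ⋃ l ∈ s, S l, m i :=
      biSup_mono fun i hi => Set.mem_biUnion (t := S) hl hi
    exact hsub _ (hE l)

/-- At least one of finitely many independent events of probability at least `e` occurs. -/
lemma one_sub_exp_le_measureReal_iUnion {Ω ι : Type*} [mΩ : MeasurableSpace Ω] {μ : Measure Ω}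
    [IsProbabilityMeasure μ] {m : ι → MeasurableSpace Ω} (hm : iIndep m μ) (hle : ∀ i, m i ≤ mΩ)
    {K : ℕ} {S : Fin K → Set ι} (hS : Pairwise (Function.onFun Disjoint S)) {E : Fin K → Set Ω}
    (hE : ∀ k, MeasurableSet[⨆ i ∈ S k, m i] (E k)) {e : ℝ} (he : ∀ k, e ≤ μ.real (E k)) :
    1 - Real.exp (-(K * e)) ≤ μ.real (⋃ k, E k) := by
  have hEm : ∀ k, MeasurableSet (E k) := fun k => iSup₂_le (fun i _ => hle i) _ (hE k)
  have hprod := measure_biInter_of_iIndep hm hle hS (E := fun k => (E k)ᶜ)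
    (fun k => (hE k).compl) univ
  have hc : (⋃ k, E k)ᶜ = ⋂ k ∈ (univ : Finset (Fin K)), (E k)ᶜ := by simp
  have h1 : μ.real (⋃ k, E k)ᶜ = ∏ k, μ.real (E k)ᶜ := by
    simp only [measureReal_def, ← ENNReal.toReal_prod]
    rw [hc, hprod]
  have h2 : μ.real (⋃ k, E k)ᶜ ≤ Real.exp (-(K * e)) := by
    rw [h1]
    calc ∏ k, μ.real (E k)ᶜ ≤ ∏ _k : Fin K, Real.exp (-e) := by
          refine prod_le_prod (fun _ _ => measureReal_nonneg) fun k _ => ?_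
          rw [probReal_compl_eq_one_sub (hEm k)]
          have := Real.add_one_le_exp (-e)
          linarith [he k]
      _ = _ := by
          rw [prod_const, card_univ, Fintype.card_fin, ← Real.exp_nat_mul]
          congr 1; ring
  rw [probReal_compl_eq_one_sub (MeasurableSet.iUnion hEm)] at h2
  linarith

/-! ### Lower bound on the mean sum-rate. -/

section Lower

variable {Ω : Type*} {p : ℝ} {L : Measure ℝ} {B K N : ℕ}
  {X : Fin K → Ω → ℂ} {ν : Fin B → Fin K → Fin N → Ω → ℂ}

/-- Interference power at user `k` when all the transmitters other than `i` use power `P`. -/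
noncomputable def interference (α β r₀ P : ℝ) (a : Fin B → ℂ) (X : Fin K → Ω → ℂ)
    (ν : Fin B → Fin K → Fin N → Ω → ℂ) (i : Fin B) (k : Fin K) (n : Fin N) (ω : Ω) : ℝ :=
  ∑ j ∈ univ.erase i, P * (β ^ 2 * pathGain α r₀ (a j) (X k ω) * ‖ν j k n ω‖ ^ 2)

lemma measurable_interference (α β r₀ P : ℝ) (a : Fin B → ℂ) [mΩ : MeasurableSpace Ω] {k : Fin K}
    {n : Fin N} (hX : Measurable (X k)) (hν : ∀ j, Measurable (ν j k n)) (i : Fin B) :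
    Measurable (interference α β r₀ P a X ν i k n) := by
  unfold interference
  refine Finset.measurable_fun_sum _ fun j _ => ?_
  exact ((((measurable_pathGain α r₀ (a j)).comp hX).const_mul _).mul
    ((hν j).norm.pow_const 2)).const_mul _

/-- User `k` is close to TX `i`, with strong fading and weak interference. -/
def goodEvent (α β r₀ P y M : ℝ) (a : Fin B → ℂ) (X : Fin K → Ω → ℂ)
    (ν : Fin B → Fin K → Fin N → Ω → ℂ) (i : Fin B) (n : Fin N) (k : Fin K) : Set Ω :=
  ({ω | ‖X k ω - a i‖ ≤ r₀} ∩ {ω | y < ‖ν i k n ω‖ ^ 2}) ∩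
    {ω | interference α β r₀ P a X ν i k n ω ≤ M}

lemma measurableSet_goodEvent (α β r₀ P y M : ℝ) (a : Fin B → ℂ) [mΩ : MeasurableSpace Ω] {k : Fin K}
    {n : Fin N} (hX : Measurable (X k)) (hν : ∀ j, Measurable (ν j k n)) (i : Fin B) :
    MeasurableSet (goodEvent α β r₀ P y M a X ν i n k) :=
  ((measurableSet_le (hX.sub_const _).norm measurable_const).inter
    (measurableSet_lt measurable_const ((hν i).norm.pow_const 2))).inter
    (measurableSet_le (measurable_interference α β r₀ P a hX hν i) measurable_const)

variable [mΩ : MeasurableSpace Ω] {μ : Measure Ω}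

lemma IsRandomChannel.measurable_elim (h : IsRandomChannel μ p L X ν)
    (s : Fin K ⊕ (Fin B × Fin K × Fin N)) :
    Measurable (Sum.elim X (fun q => ν q.1 q.2.1 q.2.2) s) := by
  rcases s with k | ⟨i, k, n⟩
  exacts [h.measurable_location k, h.measurable_fading i k n]

/-- Mean interference power on the event of a close user with strong fading. -/
lemma IsRandomChannel.lintegral_interference_le (h : IsRandomChannel μ p L X ν)
    {α β r₀ P y S V : ℝ} (hP : 0 < P) (hS : 0 < S)
    (hVL : ∫⁻ x, ENNReal.ofReal (x ^ 2) ∂L ≤ ENNReal.ofReal V)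
    (a : Fin B → ℂ) (ha : ∀ z, ∑ j, pathGain α r₀ (a j) z ≤ S) (i : Fin B) (n : Fin N) (k : Fin K) :
    ∫⁻ ω in {ω | ‖X k ω - a i‖ ≤ r₀} ∩ {ω | y < ‖ν i k n ω‖ ^ 2},
      ENNReal.ofReal (interference α β r₀ P a X ν i k n ω) ∂μ ≤
    ENNReal.ofReal (P * β ^ 2 * S * V) *
      (μ {ω | ‖X k ω - a i‖ ≤ r₀} * μ {ω | y < ‖ν i k n ω‖ ^ 2}) := by
  have hXm := h.measurable_location k
  have hνm : ∀ j, Measurable (ν j k n) := fun j => h.measurable_fading j k n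
  set A : Set ℂ := {z | ‖z - a i‖ ≤ r₀} with hA
  set F : Set ℂ := {z | y < ‖z‖ ^ 2} with hF
  have hAm : MeasurableSet A := measurableSet_le (measurable_id.sub_const _).norm measurable_const
  have hFm : MeasurableSet F := measurableSet_lt measurable_const (measurable_norm.pow_const 2)
  have hgm : ∀ j, Measurable (A.indicator fun z => ENNReal.ofReal (pathGain α r₀ (a j) z)) :=
    fun j => (measurable_pathGain α r₀ (a j)).ennreal_ofReal.indicator hAm
  have hgX : ∀ j, Measurable fun ω =>
      A.indicator (fun z => ENNReal.ofReal (pathGain α r₀ (a j) z)) (X k ω) :=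
    fun j => (hgm j).comp hXm
  have hfm : Measurable (F.indicator (1 : ℂ → ℝ≥0∞)) := measurable_one.indicator hFm
  have hqm : Measurable fun x : ℝ => ENNReal.ofReal (x ^ 2) :=
    (measurable_id.pow_const 2).ennreal_ofReal
  have hμF : ∫⁻ ω, F.indicator (1 : ℂ → ℝ≥0∞) (ν i k n ω) ∂μ = μ (ν i k n ⁻¹' F) := by
    rw [← lintegral_map hfm (hνm i), lintegral_indicator_one hFm, Measure.map_apply (hνm i) hFm]
  have hterm : ∀ j ∈ univ.erase i,
      ∫⁻ ω, A.indicator (fun z => ENNReal.ofReal (pathGain α r₀ (a j) z)) (X k ω) *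
        F.indicator 1 (ν i k n ω) * ENNReal.ofReal (‖ν j k n ω‖ ^ 2) ∂μ ≤
      (∫⁻ ω, A.indicator (fun z => ENNReal.ofReal (pathGain α r₀ (a j) z)) (X k ω) ∂μ) *
        μ (ν i k n ⁻¹' F) * ENNReal.ofReal V := by
    intro j hj
    have hji : j ≠ i := (mem_erase.1 hj).1
    -- Since `j ≠ i`, the interfering fading is independent of the pair (location, own fading), so
    -- conditioning on a strong own link does not bias it.
    have hpair := h.indep.indepFun_prodMk h.measurable_elim (Sum.inl k) (Sum.inr (i, k, n))
      (Sum.inr (j, k, n)) (by simp) (by simpa using hji.symm)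
    have hpm : Measurable fun z : ℂ × ℂ =>
        A.indicator (fun z => ENNReal.ofReal (pathGain α r₀ (a j) z)) z.1 * F.indicator 1 z.2 :=
      ((hgm j).comp measurable_fst).mul (hfm.comp measurable_snd)
    have e1 := lintegral_mul_eq_lintegral_mul_lintegral_of_indepFun
      (hpm.comp (hXm.prodMk (hνm i))) (hqm.comp (hνm j).norm) (hpair.comp hpm
        (hqm.comp measurable_norm))
    have e2 := lintegral_mul_eq_lintegral_mul_lintegral_of_indepFun
      ((hgm j).comp hXm) (hfm.comp (hνm i)) ((h.indepFun_location_fading i k k n).comp (hgm j) hfm)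
    simp only [Pi.mul_apply, Function.comp] at e1 e2
    rw [e1, e2, hμF, h.lintegral_fading j k n hqm]
    gcongr
  calc _ = ∑ j ∈ univ.erase i, ENNReal.ofReal (P * β ^ 2) *
        ∫⁻ ω, A.indicator (fun z => ENNReal.ofReal (pathGain α r₀ (a j) z)) (X k ω) *
          F.indicator 1 (ν i k n ω) * ENNReal.ofReal (‖ν j k n ω‖ ^ 2) ∂μ := by
        have hAF : MeasurableSet (X k ⁻¹' A ∩ ν i k n ⁻¹' F) := (hXm hAm).inter (hνm i hFm)
        change ∫⁻ ω in X k ⁻¹' A ∩ ν i k n ⁻¹' F, _ ∂μ = _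
        rw [← lintegral_indicator hAF]
        simp_rw [← lintegral_const_mul' (ENNReal.ofReal (P * β ^ 2)) _ ENNReal.ofReal_ne_top]
        rw [← lintegral_finsetSum]
        · refine lintegral_congr fun ω => ?_
          by_cases h1 : X k ω ∈ A
          · by_cases h2 : ν i k n ω ∈ F
            · have h12 : ω ∈ X k ⁻¹' A ∩ ν i k n ⁻¹' F := ⟨h1, h2⟩
              rw [Set.indicator_of_mem h12, interference,
                ENNReal.ofReal_sum_of_nonneg fun j _ => by
                  have := pathGain_nonneg α r₀ (a j) (X k ω); positivity]
              refine sum_congr rfl fun j _ => ?_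
              have := pathGain_nonneg α r₀ (a j) (X k ω)
              rw [Set.indicator_of_mem h1, Set.indicator_of_mem h2, Pi.one_apply, mul_one,
                ← ENNReal.ofReal_mul this, ← ENNReal.ofReal_mul (by positivity)]
              congr 1; ring
            · rw [Set.indicator_of_notMem fun h => h2 h.2]
              simp [Set.indicator_of_notMem h2]
          · rw [Set.indicator_of_notMem fun h => h1 h.1]
            simp [Set.indicator_of_notMem h1]
        · exact fun j _ => ((((hgm j).comp hXm).mul (hfm.comp (hνm i))).mul
            (hqm.comp (hνm j).norm)).const_mul _
    _ ≤ ∑ j ∈ univ.erase i, ENNReal.ofReal (P * β ^ 2) *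
        ((∫⁻ ω, A.indicator (fun z => ENNReal.ofReal (pathGain α r₀ (a j) z)) (X k ω) ∂μ) *
        μ (ν i k n ⁻¹' F) * ENNReal.ofReal V) := by
        refine sum_le_sum fun j hj => ?_
        gcongr
        exact hterm j hj
    _ = ENNReal.ofReal (P * β ^ 2) * μ (ν i k n ⁻¹' F) * ENNReal.ofReal V *
        ∫⁻ ω, ∑ j ∈ univ.erase i,
          A.indicator (fun z => ENNReal.ofReal (pathGain α r₀ (a j) z)) (X k ω) ∂μ := by
        rw [lintegral_finsetSum _ fun j _ => hgX j, mul_sum]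
        refine sum_congr rfl fun j _ => ?_
        ring
    _ ≤ ENNReal.ofReal (P * β ^ 2) * μ (ν i k n ⁻¹' F) * ENNReal.ofReal V *
        (ENNReal.ofReal S * μ (X k ⁻¹' A)) := by
        gcongr
        calc _ ≤ ∫⁻ ω, (X k ⁻¹' A).indicator (fun _ => ENNReal.ofReal S) ω ∂μ := by
              refine lintegral_mono fun ω => ?_
              by_cases h1 : X k ω ∈ A
              · rw [Set.indicator_of_mem (show ω ∈ X k ⁻¹' A from h1)]
                simp only [Set.indicator_of_mem h1]
                rw [← ENNReal.ofReal_sum_of_nonneg fun j _ => pathGain_nonneg _ _ _ _]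
                refine ENNReal.ofReal_le_ofReal (le_trans ?_ (ha (X k ω)))
                exact sum_le_sum_of_subset_of_nonneg (erase_subset _ _)
                  fun j _ _ => pathGain_nonneg _ _ _ _
              · simp [Set.indicator_of_notMem h1]
          _ = _ := lintegral_indicator_const (hXm hAm) _
    _ = _ := by
        rw [ENNReal.ofReal_mul (by positivity : 0 ≤ P * β ^ 2 * S),
          ENNReal.ofReal_mul (by positivity : 0 ≤ P * β ^ 2)]
        change _ = _ * (μ (X k ⁻¹' A) * μ (ν i k n ⁻¹' F))
        ring

variable [IsProbabilityMeasure μ]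

/-- The interference threshold is twice the bound on the conditional mean, so Markov's inequality
discards at most half of the event of a close user with strong fading. -/
lemma IsRandomChannel.half_mul_le_measure_goodEvent (h : IsRandomChannel μ p L X ν)
    {α β r₀ P y S V : ℝ} (hβ : 0 < β) (hP : 0 < P) (hS : 0 < S) (hV : 0 < V)
    (hVL : ∫⁻ x, ENNReal.ofReal (x ^ 2) ∂L ≤ ENNReal.ofReal V)
    (a : Fin B → ℂ) (ha : ∀ z, ∑ j, pathGain α r₀ (a j) z ≤ S) (i : Fin B) (n : Fin N) (k : Fin K) :
    μ.real {ω | ‖X k ω - a i‖ ≤ r₀} * L.real {x | y < x ^ 2} / 2 ≤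
      μ.real (goodEvent α β r₀ P y (2 * (P * β ^ 2 * S * V)) a X ν i n k) := by
  have hXm := h.measurable_location k
  have hνm : ∀ j, Measurable (ν j k n) := fun j => h.measurable_fading j k n
  set Q := P * β ^ 2 * S * V with hQ
  have hQ0 : 0 < Q := by positivity
  set A : Set Ω := {ω | ‖X k ω - a i‖ ≤ r₀} with hA
  set F : Set Ω := {ω | y < ‖ν i k n ω‖ ^ 2} with hF
  set I := interference α β r₀ P a X ν i k n with hI
  have hIm : Measurable I := measurable_interference α β r₀ P a hXm hνm i
  have hI0 : ∀ ω, 0 ≤ I ω := fun ω => sum_nonneg fun j _ => by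
    have := pathGain_nonneg α r₀ (a j) (X k ω); positivity
  have hAm : MeasurableSet {z : ℂ | ‖z - a i‖ ≤ r₀} :=
    measurableSet_le (measurable_id.sub_const _).norm measurable_const
  have hFm : MeasurableSet {z : ℂ | y < ‖z‖ ^ 2} :=
    measurableSet_lt measurable_const (measurable_norm.pow_const 2)
  have hAF : MeasurableSet (A ∩ F) := (hXm hAm).inter (hνm i hFm)
  have hind : μ (A ∩ F) = μ A * μ F :=
    (h.indepFun_location_fading i k k n).measure_inter_preimage_eq_mul _ _ hAm hFm
  have hLF : L.real {x | y < x ^ 2} = μ.real F :=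
    ((h.fading_law i k n).measureReal_eq
      (measurableSet_lt measurable_const (measurable_id.pow_const 2))).symm
  have hmarkov : μ.real ((A ∩ F) ∩ {ω | 2 * Q ≤ I ω}) ≤ μ.real A * μ.real F / 2 := by
    have h1 := mul_meas_ge_le_lintegral (μ := μ.restrict (A ∩ F)) hIm.ennreal_ofReal
      (ENNReal.ofReal (2 * Q))
    have h2 := h1.trans (h.lintegral_interference_le hP hS hVL a ha i n k)
    have e : {ω | ENNReal.ofReal (2 * Q) ≤ ENNReal.ofReal (I ω)} = {ω | 2 * Q ≤ I ω} := by
      ext ω; exact ENNReal.ofReal_le_ofReal_iff (hI0 ω)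
    rw [e, Measure.restrict_apply (measurableSet_le measurable_const hIm), Set.inter_comm] at h2
    have h3 := ENNReal.toReal_mono (by finiteness) h2
    rw [ENNReal.toReal_mul, ENNReal.toReal_mul, ENNReal.toReal_mul,
      ENNReal.toReal_ofReal (by positivity), ENNReal.toReal_ofReal (by positivity)] at h3
    change 2 * Q * μ.real _ ≤ Q * (μ.real A * μ.real F) at h3
    have h4 : Q * (2 * μ.real ((A ∩ F) ∩ {ω | 2 * Q ≤ I ω})) ≤ Q * (μ.real A * μ.real F) := by
      linarith
    have := le_of_mul_le_mul_left h4 hQ0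
    linarith
  have hsplit : μ.real (A ∩ F) ≤ μ.real (goodEvent α β r₀ P y (2 * Q) a X ν i n k) +
      μ.real ((A ∩ F) ∩ {ω | 2 * Q ≤ I ω}) := by
    refine (measureReal_mono ?_).trans (measureReal_union_le _ _)
    intro ω hω
    rcases le_total (I ω) (2 * Q) with h1 | h1
    · exact Or.inl ⟨hω, h1⟩
    · exact Or.inr ⟨hω, h1⟩
  have hindr : μ.real (A ∩ F) = μ.real A * μ.real F := by
    simp only [measureReal_def, hind, ENNReal.toReal_mul]
  rw [hLF]
  linarith

/-- The probability that TX `i` has a good user. -/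
lemma IsRandomChannel.one_sub_exp_le_measureReal_goodEvent (h : IsRandomChannel μ p L X ν)
    {α β r₀ P y M e : ℝ} (a : Fin B → ℂ) (i : Fin B) (n : Fin N)
    (he : ∀ k, e ≤ μ.real (goodEvent α β r₀ P y M a X ν i n k)) :
    1 - Real.exp (-(K * e)) ≤ μ.real (⋃ k, goodEvent α β r₀ P y M a X ν i n k) := by
  -- All variables carrying the user index `k`: the location and every fading factor of that user.
  -- These blocks are disjoint for distinct users.
  let S : Fin K → Set (Fin K ⊕ (Fin B × Fin K × Fin N)) := fun k =>
    {s | Sum.elim id (fun q => q.2.1) s = k}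
  have hS : Pairwise (Function.onFun Disjoint S) := fun k l hkl =>
    Set.disjoint_left.2 fun s hs hs' => hkl (hs.symm.trans hs')
  refine one_sub_exp_le_measureReal_iUnion h.indep.iIndep (fun s => (h.measurable_elim s).comap_le)
    hS (fun k => ?_) he
  have hgood : ∀ m : MeasurableSpace Ω, Measurable[m] (X k) → (∀ j, Measurable[m] (ν j k n)) →
      MeasurableSet[m] (goodEvent α β r₀ P y M a X ν i n k) := fun m h1 h2 =>
    measurableSet_goodEvent (mΩ := m) α β r₀ P y M a h1 h2 i
  refine hgood _ ?_ fun j => ?_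
  · exact measurable_iff_comap_le.2 (le_iSup₂_of_le (Sum.inl k) rfl le_rfl)
  · exact measurable_iff_comap_le.2 (le_iSup₂_of_le (Sum.inr (j, k, n)) rfl le_rfl)

/-- Lower bound on the mean of the maximal sum-rate. -/
lemma IsRandomChannel.le_expectedSumRate [NeZero K] [NeZero N] (h : IsRandomChannel μ p L X ν)
    {α β r₀ P y S V κ δ : ℝ} (hβ : 0 < β) (hr₀ : 0 < r₀) (hP : 0 < P) (hS : 0 < S)
    (hV : 0 < V) (hδ : 0 < δ) (hy : 0 ≤ y) (hB : 1 ≤ B) (hp : 0 < p)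
    (hpB : p ^ 2 ≤ κ ^ 2 * B)
    (hVL : ∫⁻ x, ENNReal.ofReal (x ^ 2) ∂L ≤ ENNReal.ofReal V)
    (hL : δ / (K / B) ≤ L.real {x | y < x ^ 2})
    (a : Fin B → ℂ) (ha : ∀ z, ∑ j, pathGain α r₀ (a j) z ≤ S) (hap : ∀ i, ‖a i‖ + r₀ ≤ p)
    (hint : Integrable (randomMaxSumRate α β r₀ P a X ν) μ) :
    B * ((1 - Real.exp (-(r₀ ^ 2 * δ / (2 * κ ^ 2)))) *
      Real.log (1 + P * (β ^ 2 * (r₀ ^ (-α)) ^ 2) / (1 + 2 * (P * β ^ 2 * S * V)) * y)) ≤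
      expectedSumRate α β r₀ P a μ X ν := by
  classical
  have hBpos : (0 : ℝ) < B := by exact_mod_cast hB
  have hKpos : (0 : ℝ) < K := by exact_mod_cast Nat.pos_of_ne_zero (NeZero.ne K)
  set M := 2 * (P * β ^ 2 * S * V) with hM
  have hM0 : 0 < M := by positivity
  set c := P * (β ^ 2 * (r₀ ^ (-α)) ^ 2) * y with hc
  have hc0 : 0 ≤ c := by positivity
  have hce : P * (β ^ 2 * (r₀ ^ (-α)) ^ 2) / (1 + M) * y = c / (1 + M) := by rw [hc]; ring
  rw [hce]
  have hlog : 0 ≤ Real.log (1 + c / (1 + M)) := by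
    apply Real.log_nonneg
    have : 0 ≤ c / (1 + M) := by positivity
    linarith
  let G : Fin B → Set Ω := fun i => ⋃ k, goodEvent α β r₀ P y M a X ν i 0 k
  have hGm : ∀ i, MeasurableSet (G i) := fun i => MeasurableSet.iUnion fun k =>
    measurableSet_goodEvent α β r₀ P y M a (h.measurable_location k)
      (fun j => h.measurable_fading j k 0) i
  have hG : ∀ i, 1 - Real.exp (-(r₀ ^ 2 * δ / (2 * κ ^ 2))) ≤ μ.real (G i) := by
    intro i
    have he : ∀ k, r₀ ^ 2 / p ^ 2 * (δ / (K / B)) / 2 ≤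
        μ.real (goodEvent α β r₀ P y M a X ν i 0 k) := by
      intro k
      refine le_trans ?_ (h.half_mul_le_measure_goodEvent hβ hP hS hV hVL a ha i 0 k)
      have hA : μ.real {ω | ‖X k ω - a i‖ ≤ r₀} = r₀ ^ 2 / p ^ 2 := by
        rw [measureReal_def, measure_norm_sub_le_uniform (h.measurable_location k) hp
          (h.uniform_location k) hr₀.le (hap i), ENNReal.toReal_ofReal (by positivity)]
      rw [hA]
      gcongr
    refine le_trans ?_ (h.one_sub_exp_le_measureReal_goodEvent a i 0 he)
    -- `K` times the success probability of one user no longer depends on `K`, and `p² / B ≤ κ²`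
    -- bounds it below.
    have e : K * (r₀ ^ 2 / p ^ 2 * (δ / (K / B)) / 2) = r₀ ^ 2 * δ / (2 * (p ^ 2 / B)) := by
      field_simp
    rw [e]
    have : p ^ 2 / B ≤ κ ^ 2 := by rwa [div_le_iff₀ hBpos]
    gcongr
  have hle : ∀ ω, ∑ i, (G i).indicator (fun _ => Real.log (1 + c / (1 + M))) ω ≤
      randomMaxSumRate α β r₀ P a X ν ω := by
    intro ω
    have := sum_log_le_maxSumRate (P := P) hP.le
      (fun i k n => snr_nonneg α β r₀ a (fun k => X k ω) (fun i k n => ν i k n ω) i k n) 0 hc0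
      (M := M) (fun i => ω ∈ G i) (fun i hi => by
        obtain ⟨k, ⟨h1, h2⟩, h3⟩ := Set.mem_iUnion.1 hi
        refine ⟨k, ?_, ?_⟩
        · rw [snr_eq, pathGain_eq_of_norm_le h1, hc, mul_assoc]
          have h2' : y < ‖ν i k 0 ω‖ ^ 2 := h2
          gcongr
        · simp only [snr_eq]
          exact h3)
    simpa only [Set.indicator_apply, randomMaxSumRate] using this
  calc _ ≤ ∑ i, μ.real (G i) * Real.log (1 + c / (1 + M)) := by
        have := card_nsmul_le_sum (univ : Finset (Fin B))
          (fun i => μ.real (G i) * Real.log (1 + c / (1 + M)))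
          ((1 - Real.exp (-(r₀ ^ 2 * δ / (2 * κ ^ 2)))) * Real.log (1 + c / (1 + M))) fun i _ => ?_
        · simpa using this
        exact mul_le_mul_of_nonneg_right (hG i) hlog
    _ = ∫ ω, ∑ i, (G i).indicator (fun _ => Real.log (1 + c / (1 + M))) ω ∂μ := by
        rw [integral_finsetSum _ fun i _ => (integrable_const _).indicator (hGm i)]
        simp [integral_indicator_const, hGm]
    _ ≤ _ := integral_mono (integrable_finsetSum _ fun i _ =>
        (integrable_const _).indicator (hGm i)) hint hle

end Lower

end Network

/-! ### From tail estimates of the fading law to the scaling law. -/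

open Filter
open scoped ENNReal

/-- The two-sided tail estimates of a fading law that give the scaling `g`: truncation of the
fading power at `Y` leaves a mean `O(Y / s)`, a level `y` is exceeded with probability of order at
least `1 / s`, and both `log Y` and `log y` are of order `g s`. -/
structure HasTailProfile (L : Measure ℝ) (g : ℝ → ℝ) : Prop where
  moment : ∫⁻ x, ENNReal.ofReal (x ^ 2) ∂L ≠ ∞
  tendsto : Tendsto g atTop atTop
  upper : ∀ c > 0, ∃ C : ℝ, ∀ᶠ s in atTop, ∃ Y > 0,
    ∫⁻ x in {x | Y < x ^ 2}, ENNReal.ofReal (x ^ 2) ∂L ≤ ENNReal.ofReal (Y / s) ∧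
      Real.log (1 + c * Y) ≤ C * g s
  lower : ∀ c > 0, ∃ C > 0, ∃ δ > 0, ∀ᶠ s in atTop, ∃ y ≥ 0,
    ENNReal.ofReal (δ / s) ≤ L {x | y < x ^ 2} ∧ C * g s ≤ Real.log (1 + c * y)

/-- Both mean bounds are applied at `s = K / B`. Every constant is fixed before the network and the
probability space are introduced, which gives the required uniformity. -/
theorem HasTailProfile.hasScalingLaw {L : Measure ℝ} {g : ℝ → ℝ} (hL : HasTailProfile L g)
    {α β r₀ R P κ₁ κ₂ : ℝ} (hα : 1 < α) (hβ : 0 < β) (hr₀ : 0 < r₀) (hR : r₀ < R)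
    (hP : 0 < P) (hκ₁ : 0 < κ₁) (hκ₂ : 0 < κ₂) :
    HasScalingLaw.{v} α β r₀ R P κ₁ κ₂ L g := by
  have hR0 : 0 < R := hr₀.trans hR
  have hr : 0 < (r₀ ^ (-α)) ^ 2 := pow_pos (Real.rpow_pos_of_pos hr₀ _) 2
  obtain ⟨S, hS, hpack⟩ := exists_sum_pathGain_le hα hr₀ hR0
  set V := (∫⁻ x, ENNReal.ofReal (x ^ 2) ∂L).toReal + 1 with hV
  have hV0 : 0 < V := by positivity
  have hVL : ∫⁻ x, ENNReal.ofReal (x ^ 2) ∂L ≤ ENNReal.ofReal V :=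
    (ENNReal.le_ofReal_iff_toReal_le hL.moment hV0.le).2 (by linarith)
  obtain ⟨C, hC⟩ := hL.upper (P * (β ^ 2 * (r₀ ^ (-α)) ^ 2)) (by positivity)
  obtain ⟨C', hC'0, δ, hδ, hC'⟩ := hL.lower
    (P * (β ^ 2 * (r₀ ^ (-α)) ^ 2) / (1 + 2 * (P * β ^ 2 * S * V))) (by positivity)
  set D := (totalGain α r₀).toReal / (Real.pi * (κ₁ * R) ^ 2 * (r₀ ^ (-α)) ^ 2) with hD
  have hD0 : 0 ≤ D := by positivity
  set η := r₀ ^ 2 * δ / (2 * (κ₂ * R) ^ 2) with hη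
  have hη0 : 0 < η := by positivity
  have hexp : 0 < 1 - Real.exp (-η) := by
    have : Real.exp (-η) < 1 := Real.exp_lt_one_iff.2 (by linarith)
    linarith
  obtain ⟨ρ₀, hρ₀⟩ := eventually_atTop.1
    (hC.and (hC'.and ((hL.tendsto.eventually_ge_atTop 1).and (eventually_gt_atTop 0))))
  -- For large `s` one has `g s ≥ 1`, so the additive constant `D` is absorbed into a multiple of `g
  -- s`. The sign of `C` is unknown, hence `|C|`; the `1` ensures positivity.
  refine ⟨|C| + D + 1, by positivity, (1 - Real.exp (-η)) * C', by positivity, ρ₀, ?_⟩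
  intro B K N hB hK hN hρ p a hnet Ω _ μ _ X ν hch
  have : NeZero K := ⟨by omega⟩
  have : NeZero N := ⟨by omega⟩
  obtain ⟨⟨Y, hY, hYL, hYg⟩, ⟨y, hy, hyL, hyg⟩, hg1, hs⟩ := hρ₀ _ hρ
  have hBpos : (0 : ℝ) < B := by exact_mod_cast hB
  have hp : 0 < p := hR0.trans hnet.radius_gt
  have hsq : Real.sqrt B ^ 2 = B := Real.sq_sqrt hBpos.le
  have hp1 : (κ₁ * R) ^ 2 * B ≤ p ^ 2 := by
    rw [← hsq, ← mul_pow, mul_assoc]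
    exact pow_le_pow_left₀ (by positivity) hnet.le_radius 2
  have hp2 : p ^ 2 ≤ (κ₂ * R) ^ 2 * B := by
    rw [← hsq, ← mul_pow, mul_assoc]
    exact pow_le_pow_left₀ hp.le hnet.radius_le 2
  have hup := hch.lintegral_randomMaxSumRate_le hα hβ hr₀ hP (mul_pos hκ₁ hR0) hB hp hp1 hY hYL a
  have hmeas : Measurable (randomMaxSumRate α β r₀ P a X ν) :=
    measurable_randomMaxSumRate hP.le a hch.measurable_location hch.measurable_fading
  have h0 : ∀ ω, 0 ≤ randomMaxSumRate α β r₀ P a X ν ω := fun ω =>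
    maxSumRate_nonneg hP.le fun i k n => snr_nonneg _ _ _ _ _ _ _ _ _
  have hint : Integrable (randomMaxSumRate α β r₀ P a X ν) μ :=
    (lintegral_ofReal_ne_top_iff_integrable hmeas.aestronglyMeasurable (ae_of_all _ h0)).1
      (hup.trans_lt ENNReal.ofReal_lt_top).ne
  refine ⟨hint, ?_, ?_⟩
  · have hlog : 0 ≤ Real.log (1 + P * (β ^ 2 * (r₀ ^ (-α)) ^ 2) * Y) :=
      Real.log_nonneg (by
        have : 0 < P * (β ^ 2 * (r₀ ^ (-α)) ^ 2) * Y := by positivity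
        linarith)
    have h1 : expectedSumRate α β r₀ P a μ X ν ≤
        B * N * (Real.log (1 + P * (β ^ 2 * (r₀ ^ (-α)) ^ 2) * Y) + D) := by
      rw [expectedSumRate, integral_eq_lintegral_of_nonneg_ae (ae_of_all _ h0)
        hmeas.aestronglyMeasurable]
      exact ENNReal.toReal_le_of_le_ofReal (by positivity) hup
    refine h1.trans ?_
    have h2 : Real.log (1 + P * (β ^ 2 * (r₀ ^ (-α)) ^ 2) * Y) + D ≤ (|C| + D + 1) * g (K / B) := by
      have := le_abs_self C
      nlinarith
    calc _ ≤ B * N * ((|C| + D + 1) * g (K / B)) := by gcongr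
      _ = _ := by ring
  · obtain ⟨o, θ, hgrid⟩ := hnet.mem_grid
    have hsep : ∀ i j, i ≠ j → 2 * R ≤ dist (a i) (a j) := fun i j hij =>
      dist_hexGrid hR0 (hgrid i) (hgrid j) (hnet.injective.ne hij)
    have : IsProbabilityMeasure L :=
      (hch.fading_law ⟨0, by omega⟩ 0 0).isProbabilityMeasure_iff.1 inferInstance
    have hyL' : δ / (K / B) ≤ L.real {x | y < x ^ 2} :=
      (ENNReal.ofReal_le_iff_le_toReal (measure_ne_top _ _)).1 hyL
    refine le_trans ?_ (hch.le_expectedSumRate hβ hr₀ hP hS hV0 hδ hy hB hp hp2 hVL hyL' a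
      (hpack a hsep) (fun i => by linarith [hnet.norm_le i]) hint)
    calc _ = B * ((1 - Real.exp (-η)) * (C' * g (K / B))) := by ring
      _ ≤ _ := by gcongr

/-! ### Stretched exponential laws, covering Nakagami and Weibull. -/

/-- Law with density `A x ^ e exp (-θ x ^ t)` on the positive half-line. -/
noncomputable def stretchedExponential (A e θ t : ℝ) : Measure ℝ :=
  volume.withDensity fun x => ENNReal.ofReal
    (if 0 < x then A * x ^ e * Real.exp (-θ * x ^ t) else 0)

section StretchedExponential

variable {A e θ t : ℝ}

lemma measurable_stretchedExponential_density (A e θ t : ℝ) : Measurable fun x : ℝ =>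
    ENNReal.ofReal (if 0 < x then A * x ^ e * Real.exp (-θ * x ^ t) else 0) := by
  refine (Measurable.ite measurableSet_Ioi ?_ measurable_const).ennreal_ofReal
  fun_prop

lemma lintegral_rpow_mul_exp_lt_top (he : -1 < e) (hθ : 0 < θ) (ht : 0 < t) :
    ∫⁻ x in Set.Ioi (0 : ℝ), ENNReal.ofReal (A * x ^ e * Real.exp (-θ * x ^ t)) < ∞ := by
  -- Were the function not integrable, its Bochner integral would be `0` by convention,
  -- contradicting the positive Gamma value.
  have hint : IntegrableOn (fun x : ℝ => x ^ e * Real.exp (-θ * x ^ t)) (Set.Ioi 0) := by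
    by_contra h
    have h1 := integral_rpow_mul_exp_neg_mul_rpow ht he hθ
    rw [integral_undef h] at h1
    have h2 : 0 < Real.Gamma ((e + 1) / t) := Real.Gamma_pos_of_pos (div_pos (by linarith) ht)
    have h3 : 0 < θ ^ (-(e + 1) / t) := Real.rpow_pos_of_pos hθ _
    have : 0 < θ ^ (-(e + 1) / t) * (1 / t) * Real.Gamma ((e + 1) / t) := by positivity
    exact this.ne h1
  have := (hint.const_mul A).lintegral_lt_top
  simpa only [mul_assoc] using this

/-- Exponential moment controlling the truncated second moment. -/
lemma setLIntegral_sq_stretchedExponential_le (hA : 0 < A) (hθ : 0 < θ) (ht : 0 < t) {Y : ℝ}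
    (hY : 0 ≤ Y) :
    ∫⁻ x in {x | Y < x ^ 2}, ENNReal.ofReal (x ^ 2) ∂(stretchedExponential A e θ t) ≤
      ENNReal.ofReal (Real.exp (-(θ / 2) * Y ^ (t / 2))) *
        ∫⁻ x in Set.Ioi (0 : ℝ), ENNReal.ofReal (A * x ^ (e + 2) * Real.exp (-(θ / 2) * x ^ t)) := by
  have hms : MeasurableSet {x : ℝ | Y < x ^ 2} :=
    measurableSet_lt measurable_const (measurable_id.pow_const 2)
  have hqm : Measurable fun x : ℝ => ENNReal.ofReal (x ^ 2) :=
    (measurable_id.pow_const 2).ennreal_ofReal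
  rw [stretchedExponential, setLIntegral_withDensity_eq_setLIntegral_mul _
    (measurable_stretchedExponential_density A e θ t) hqm hms,
    ← lintegral_const_mul' _ _ ENNReal.ofReal_ne_top, ← lintegral_indicator measurableSet_Ioi,
    ← lintegral_indicator hms]
  refine lintegral_mono fun x => ?_
  by_cases h1 : Y < x ^ 2
  · rw [Set.indicator_of_mem (show x ∈ {x : ℝ | Y < x ^ 2} from h1)]
    by_cases h2 : 0 < x
    · rw [Set.indicator_of_mem (show x ∈ Set.Ioi (0 : ℝ) from h2), Pi.mul_apply, if_pos h2]
      have hx : 0 < x ^ e := Real.rpow_pos_of_pos h2 _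
      rw [← ENNReal.ofReal_mul (by positivity), ← ENNReal.ofReal_mul (by positivity)]
      apply ENNReal.ofReal_le_ofReal
      have hxt : Y ^ (t / 2) ≤ x ^ t := by
        calc Y ^ (t / 2) ≤ (x ^ 2) ^ (t / 2) := Real.rpow_le_rpow hY h1.le (by positivity)
          _ = x ^ t := by
            rw [← Real.rpow_natCast x 2, ← Real.rpow_mul h2.le]
            congr 1; push_cast; ring
      -- The exponent is split in halves: one pays for the decay in `Y`, the other keeps the
      -- remaining integral finite.
      have hexp : Real.exp (-θ * x ^ t) ≤
          Real.exp (-(θ / 2) * Y ^ (t / 2)) * Real.exp (-(θ / 2) * x ^ t) := by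
        rw [← Real.exp_add]
        apply Real.exp_le_exp.2
        nlinarith
      have hx2 : x ^ (e + 2) = x ^ e * x ^ 2 := by
        rw [Real.rpow_add h2]; norm_num
      rw [hx2]
      calc A * x ^ e * Real.exp (-θ * x ^ t) * x ^ 2 ≤ A * x ^ e *
          (Real.exp (-(θ / 2) * Y ^ (t / 2)) * Real.exp (-(θ / 2) * x ^ t)) * x ^ 2 := by gcongr
        _ = _ := by ring
    · simp [h2]
  · rw [Set.indicator_of_notMem (show x ∉ {x : ℝ | Y < x ^ 2} from h1)]
    exact zero_le

/-- Only the mass on `(x, 2 x]` is counted. There `z ^ e ≥ z⁻¹ ≥ (2 x)⁻¹`, and the interval length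
`x` cancels this factor up to `1 / 2`. -/
lemma le_stretchedExponential_tail (hA : 0 < A) (he : -1 < e) (hθ : 0 < θ) (ht : 0 < t) {x : ℝ}
    (hx : 1 ≤ x) :
    ENNReal.ofReal (A / 2 * Real.exp (-θ * (2 * x) ^ t)) ≤
      stretchedExponential A e θ t {z | x ^ 2 < z ^ 2} := by
  have hx0 : 0 < x := by linarith
  have hms : MeasurableSet {z : ℝ | x ^ 2 < z ^ 2} :=
    measurableSet_lt measurable_const (measurable_id.pow_const 2)
  have hsub : Set.Ioc x (2 * x) ⊆ {z : ℝ | x ^ 2 < z ^ 2} := fun z hz =>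
    pow_lt_pow_left₀ hz.1 hx0.le two_ne_zero
  rw [stretchedExponential, withDensity_apply _ hms]
  calc ENNReal.ofReal (A / 2 * Real.exp (-θ * (2 * x) ^ t))
      = ∫⁻ _ in Set.Ioc x (2 * x),
          ENNReal.ofReal (A * (2 * x)⁻¹ * Real.exp (-θ * (2 * x) ^ t)) := by
        rw [setLIntegral_const, Real.volume_Ioc, ← ENNReal.ofReal_mul (by positivity)]
        congr 1
        field_simp
        ring
    _ ≤ ∫⁻ z in Set.Ioc x (2 * x), ENNReal.ofReal
          (if 0 < z then A * z ^ e * Real.exp (-θ * z ^ t) else 0) := by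
        refine setLIntegral_mono' measurableSet_Ioc fun z hz => ?_
        have hz0 : 0 < z := hx0.trans hz.1
        rw [if_pos hz0]
        apply ENNReal.ofReal_le_ofReal
        have h1 : (2 * x)⁻¹ ≤ z ^ e := by
          calc (2 * x)⁻¹ ≤ z⁻¹ := inv_anti₀ hz0 hz.2
            _ = z ^ (-1 : ℝ) := (Real.rpow_neg_one z).symm
            _ ≤ z ^ e := Real.rpow_le_rpow_of_exponent_le (hx.trans hz.1.le) he.le
        have h2 : z ^ t ≤ (2 * x) ^ t := Real.rpow_le_rpow hz0.le hz.2 ht.le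
        have h3 : -θ * (2 * x) ^ t ≤ -θ * z ^ t := by nlinarith
        have : 0 < z ^ e := Real.rpow_pos_of_pos hz0 _
        gcongr
    _ ≤ _ := lintegral_mono_set hsub

lemma hasTailProfile_stretchedExponential (hA : 0 < A) (he : -1 < e) (hθ : 0 < θ) (ht : 0 < t) :
    HasTailProfile (stretchedExponential A e θ t)
      (fun ρ => Real.log (Real.log ρ ^ (2 / t))) := by
  have ht2 : 0 < 2 / t := by positivity
  have hpow : Tendsto (fun s => Real.log s ^ (2 / t)) atTop atTop :=
    (tendsto_rpow_atTop ht2).comp Real.tendsto_log_atTop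
  have hg : Tendsto (fun s => Real.log (Real.log s ^ (2 / t))) atTop atTop :=
    Real.tendsto_log_atTop.comp hpow
  set Q := ∫⁻ x in Set.Ioi (0 : ℝ),
    ENNReal.ofReal (A * x ^ (e + 2) * Real.exp (-(θ / 2) * x ^ t)) with hQ
  have hQtop : Q < ∞ := lintegral_rpow_mul_exp_lt_top (by linarith) (by positivity) ht
  refine ⟨?_, hg, ?_, ?_⟩
  · have h1 := setLIntegral_sq_stretchedExponential_le (e := e) hA hθ ht (le_refl (0 : ℝ))
    have h2 : ∫⁻ x in {x : ℝ | 0 < x ^ 2}, ENNReal.ofReal (x ^ 2) ∂(stretchedExponential A e θ t) =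
        ∫⁻ x, ENNReal.ofReal (x ^ 2) ∂(stretchedExponential A e θ t) := by
      have hms : MeasurableSet {x : ℝ | 0 < x ^ 2} :=
        measurableSet_lt measurable_const (measurable_id.pow_const 2)
      rw [← lintegral_indicator hms]
      refine lintegral_congr fun x => ?_
      by_cases h : 0 < x ^ 2
      · exact Set.indicator_of_mem h _
      · rw [Set.indicator_of_notMem (show x ∉ {x : ℝ | 0 < x ^ 2} from h), ENNReal.ofReal_of_nonpos (not_lt.1 h)]
    rw [← h2]
    exact (h1.trans_lt (ENNReal.mul_lt_top ENNReal.ofReal_lt_top hQtop)).ne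
  · intro c hc
    -- Chosen so that `(θ / 2) (b w) ^ (t / 2) = log s` for `w = (log s) ^ (2 / t)`: the decay
    -- factor becomes exactly `1 / s`. The integral `Q` is absorbed by `Y = b w`, which tends to
    -- infinity.
    set b := (2 / θ) ^ (2 / t) with hb
    have hb0 : 0 < b := Real.rpow_pos_of_pos (by positivity) _
    refine ⟨2, ?_⟩
    filter_upwards [hpow.eventually_ge_atTop 1, hpow.eventually_ge_atTop (Q.toReal / b),
      hg.eventually_ge_atTop (Real.log (1 + c * b)), eventually_gt_atTop 1] with s h1 h2 h3 hs
    have hls : 0 < Real.log s := Real.log_pos hs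
    set w := Real.log s ^ (2 / t) with hw
    have hw0 : 0 < w := by linarith
    refine ⟨b * w, by positivity, ?_, ?_⟩
    · refine (setLIntegral_sq_stretchedExponential_le hA hθ ht (by positivity)).trans ?_
      have e1 : (b * w) ^ (t / 2) = 2 / θ * Real.log s := by
        rw [hb, hw, ← Real.mul_rpow (by positivity) hls.le, ← Real.rpow_mul (by positivity)]
        rw [show 2 / t * (t / 2) = 1 by field_simp, Real.rpow_one]
      have e2 : Real.exp (-(θ / 2) * (b * w) ^ (t / 2)) = s⁻¹ := by
        rw [e1, show -(θ / 2) * (2 / θ * Real.log s) = -Real.log s by field_simp, Real.exp_neg,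
          Real.exp_log (by linarith)]
      rw [e2, ← hQ, ← ENNReal.ofReal_toReal hQtop.ne, ← ENNReal.ofReal_mul (by positivity)]
      apply ENNReal.ofReal_le_ofReal
      rw [div_le_iff₀ hb0] at h2
      rw [inv_mul_eq_div, mul_comm b w]
      gcongr
    · calc Real.log (1 + c * (b * w)) ≤ Real.log ((1 + c * b) * w) :=
            Real.log_le_log (by positivity) (by nlinarith)
        _ = Real.log (1 + c * b) + Real.log w := Real.log_mul (by positivity) hw0.ne'
        _ ≤ 2 * Real.log w := by linarith
  · intro c hc
    -- Chosen so that `θ (2 x) ^ t = log s` at `x = √(b w)`, making the tail bound exactly `(A / 2)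
    -- / s`. The factor `1 / 2` in front of `g` leaves room for a negative `log (c b)`.
    set b := (1 / (θ * 2 ^ t)) ^ (2 / t) with hb
    have h2t : (0 : ℝ) < 2 ^ t := Real.rpow_pos_of_pos two_pos _
    have hb0 : 0 < b := Real.rpow_pos_of_pos (by positivity) _
    refine ⟨1 / 2, by positivity, A / 2, by positivity, ?_⟩
    filter_upwards [hpow.eventually_ge_atTop (1 / b),
      hg.eventually_ge_atTop (-2 * Real.log (c * b)), eventually_gt_atTop 1] with s h1 h2 hs
    have hls : 0 < Real.log s := Real.log_pos hs
    set w := Real.log s ^ (2 / t) with hw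
    have hw0 : 0 < w := Real.rpow_pos_of_pos hls _
    refine ⟨b * w, by positivity, ?_, ?_⟩
    · set x := Real.sqrt (b * w) with hx
      have hxsq : x ^ 2 = b * w := Real.sq_sqrt (by positivity)
      have hx1 : 1 ≤ x := by
        rw [hx, Real.one_le_sqrt]
        rw [div_le_iff₀ hb0] at h1
        linarith
      have h := le_stretchedExponential_tail hA he hθ ht hx1
      rw [hxsq] at h
      have e1 : x ^ t = 1 / (θ * 2 ^ t) * Real.log s := by
        rw [hx, Real.sqrt_eq_rpow, ← Real.rpow_mul (by positivity), hb, hw,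
          ← Real.mul_rpow (by positivity) hls.le, ← Real.rpow_mul (by positivity)]
        rw [show 2 / t * (1 / 2 * t) = 1 by field_simp, Real.rpow_one]
      have e2 : Real.exp (-θ * (2 * x) ^ t) = s⁻¹ := by
        rw [Real.mul_rpow two_pos.le (by linarith), e1,
          show -θ * (2 ^ t * (1 / (θ * 2 ^ t) * Real.log s)) = -Real.log s by field_simp,
          Real.exp_neg, Real.exp_log (by linarith)]
      rwa [e2, ← div_eq_mul_inv] at h
    · calc 1 / 2 * Real.log w ≤ Real.log (c * b) + Real.log w := by linarith
        _ = Real.log (c * b * w) := (Real.log_mul (by positivity) hw0.ne').symm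
        _ ≤ _ := Real.log_le_log (by positivity) (by nlinarith)

end StretchedExponential

lemma hasTailProfile_nakagami {m w : ℝ} (hm : 0 < m) (hw : 0 < w) :
    HasTailProfile (nakagami m w) (fun ρ => Real.log (Real.log ρ)) := by
  have hA : 0 < 2 * m ^ m / (Real.Gamma m * w ^ m) := by
    have := Real.Gamma_pos_of_pos hm
    have := Real.rpow_pos_of_pos hm m
    have := Real.rpow_pos_of_pos hw m
    positivity
  have h := hasTailProfile_stretchedExponential hA (e := 2 * m - 1) (θ := m / w) (t := 2)
    (by linarith) (by positivity) two_pos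
  have e1 : stretchedExponential (2 * m ^ m / (Real.Gamma m * w ^ m)) (2 * m - 1) (m / w) 2 =
      nakagami m w := by
    simp only [stretchedExponential, nakagami, Real.rpow_two]
  simpa only [e1, div_self (two_ne_zero (α := ℝ)), Real.rpow_one] using h

/-- The scale only changes the constants: it moves into the prefactor and into `θ = 1 / l ^ t`. -/
lemma hasTailProfile_weibull {l t : ℝ} (hl : 0 < l) (ht : 0 < t) :
    HasTailProfile (weibull l t) (fun ρ => Real.log (Real.log ρ ^ (2 / t))) := by
  have hlt : 0 < l ^ (t - 1) := Real.rpow_pos_of_pos hl _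
  have hlt' : 0 < l ^ t := Real.rpow_pos_of_pos hl _
  have h := hasTailProfile_stretchedExponential (A := t / l / l ^ (t - 1)) (e := t - 1)
    (θ := 1 / l ^ t) (t := t) (by positivity) (by linarith) (by positivity) ht
  have e1 : stretchedExponential (t / l / l ^ (t - 1)) (t - 1) (1 / l ^ t) t = weibull l t := by
    rw [stretchedExponential, weibull]
    congr 1
    funext x
    congr 1
    split_ifs with hx
    · rw [Real.div_rpow hx.le hl.le, Real.div_rpow hx.le hl.le]
      congr 1
      · ring
      · congr 1; ring
    · rfl
  rwa [e1] at h

/-! ### The log-normal law. -/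

section LogNormal

variable {a v : ℝ}

lemma lintegral_exp_mul_gaussianReal (a : ℝ) (hv : 0 < v) (r : ℝ) :
    ∫⁻ z, ENNReal.ofReal (Real.exp (r * z)) ∂(gaussianReal a v.toNNReal) =
      ENNReal.ofReal (Real.exp (a * r + v * r ^ 2 / 2)) := by
  rw [← ofReal_integral_eq_lintegral_ofReal (integrable_exp_mul_gaussianReal r)
    (ae_of_all _ fun z => (Real.exp_pos _).le)]
  congr 1
  have h := mgf_gaussianReal (p := gaussianReal a v.toNNReal) (X := id) Measure.map_id r
  rw [mgf, Real.coe_toNNReal v hv.le] at h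
  exact h

/-- Chernoff bound for the truncated second moment of the log-normal law. -/
lemma setLIntegral_sq_logNormal_le (hv : 0 < v) {b τ : ℝ} (hτ : 0 ≤ τ) :
    ∫⁻ x in {x | Real.exp b < x ^ 2}, ENNReal.ofReal (x ^ 2) ∂(logNormal a v) ≤
      ENNReal.ofReal (Real.exp (2 * a * (1 + τ) + 2 * v * (1 + τ) ^ 2 - τ * b)) := by
  have hms : MeasurableSet {x : ℝ | Real.exp b < x ^ 2} :=
    measurableSet_lt measurable_const (measurable_id.pow_const 2)
  have hqm : Measurable fun x : ℝ => ENNReal.ofReal (x ^ 2) :=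
    (measurable_id.pow_const 2).ennreal_ofReal
  rw [logNormal, setLIntegral_map hms hqm Real.measurable_exp]
  calc _ ≤ ∫⁻ z in Real.exp ⁻¹' {x | Real.exp b < x ^ 2}, ENNReal.ofReal (Real.exp (-(τ * b))) *
        ENNReal.ofReal (Real.exp (2 * (1 + τ) * z)) ∂(gaussianReal a v.toNNReal) := by
        refine setLIntegral_mono' (Real.measurable_exp hms) fun z hz => ?_
        have hz' : Real.exp b < Real.exp z ^ 2 := hz
        have e1 : Real.exp z ^ 2 = Real.exp (2 * z) := by
          rw [← Real.exp_nat_mul]; norm_num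
        rw [e1, Real.exp_lt_exp] at hz'
        rw [← ENNReal.ofReal_mul (Real.exp_pos _).le, ← Real.exp_add, e1]
        apply ENNReal.ofReal_le_ofReal
        apply Real.exp_le_exp.2
        -- On this set `b < 2 z`, so `τ (2 z - b) ≥ 0` can be added to the exponent.
        nlinarith
    _ ≤ ∫⁻ z, ENNReal.ofReal (Real.exp (-(τ * b))) *
        ENNReal.ofReal (Real.exp (2 * (1 + τ) * z)) ∂(gaussianReal a v.toNNReal) :=
        setLIntegral_le_lintegral _ _
    _ = _ := by
        rw [lintegral_const_mul' _ _ ENNReal.ofReal_ne_top, lintegral_exp_mul_gaussianReal a hv,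
          ← ENNReal.ofReal_mul (Real.exp_pos _).le, ← Real.exp_add]
        congr 2
        ring

/-- The Gaussian density is bounded below on the unit interval `(x, x + 1]`. Separating `a` from `x`
by `(x + 1 + |a|)² ≤ 2 x² + 2 (1 + |a|)²` costs a factor in the exponent, harmless on the scale
`√(log s)`. -/
lemma le_logNormal_tail (hv : 0 < v) {x : ℝ} (hx : 0 ≤ x) :
    ENNReal.ofReal ((Real.sqrt (2 * Real.pi * v))⁻¹ *
      Real.exp (-((1 + |a|) ^ 2 / v) - x ^ 2 / v)) ≤
      logNormal a v {z | Real.exp (2 * x) < z ^ 2} := by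
  have hms : MeasurableSet {z : ℝ | Real.exp (2 * x) < z ^ 2} :=
    measurableSet_lt measurable_const (measurable_id.pow_const 2)
  have hv' : v.toNNReal ≠ 0 := by simpa using hv
  have hsub : Set.Ioc x (x + 1) ⊆ Real.exp ⁻¹' {z : ℝ | Real.exp (2 * x) < z ^ 2} := by
    intro z hz
    have : Real.exp (2 * x) < Real.exp z ^ 2 := by
      rw [← Real.exp_nat_mul]
      apply Real.exp_lt_exp.2
      push_cast
      linarith [hz.1]
    exact this
  rw [logNormal, Measure.map_apply Real.measurable_exp hms]
  refine le_trans ?_ (measure_mono hsub)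
  rw [gaussianReal_apply _ hv']
  calc _ = ∫⁻ _ in Set.Ioc x (x + 1), ENNReal.ofReal ((Real.sqrt (2 * Real.pi * v))⁻¹ *
      Real.exp (-((1 + |a|) ^ 2 / v) - x ^ 2 / v)) := by
        rw [setLIntegral_const, Real.volume_Ioc]
        simp
    _ ≤ _ := by
        refine setLIntegral_mono' measurableSet_Ioc fun z hz => ?_
        rw [gaussianPDF, gaussianPDFReal, Real.coe_toNNReal v hv.le]
        apply ENNReal.ofReal_le_ofReal
        have h1 : |z - a| ≤ x + (1 + |a|) := by
          have h2 := abs_sub z a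
          rw [abs_of_nonneg (hx.trans hz.1.le)] at h2
          linarith [hz.2]
        have h3 : (z - a) ^ 2 ≤ 2 * x ^ 2 + 2 * (1 + |a|) ^ 2 := by
          rw [← sq_abs]
          have := pow_le_pow_left₀ (abs_nonneg _) h1 2
          nlinarith [sq_nonneg (x - (1 + |a|))]
        have h4 : -((1 + |a|) ^ 2 / v) - x ^ 2 / v ≤ -(z - a) ^ 2 / (2 * v) := by
          rw [le_div_iff₀ (by positivity)]
          have : (-((1 + |a|) ^ 2 / v) - x ^ 2 / v) * (2 * v) = -(2 * x ^ 2 + 2 * (1 + |a|) ^ 2) := by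
            field_simp; ring
          linarith
        gcongr

lemma hasTailProfile_logNormal (hv : 0 < v) :
    HasTailProfile (logNormal a v) (fun ρ => Real.sqrt (Real.log ρ)) := by
  have hg : Tendsto (fun s => Real.sqrt (Real.log s)) atTop atTop :=
    Real.tendsto_sqrt_atTop.comp Real.tendsto_log_atTop
  refine ⟨?_, hg, ?_, ?_⟩
  · have e : ∀ z : ℝ, ENNReal.ofReal (Real.exp z ^ 2) = ENNReal.ofReal (Real.exp (2 * z)) := by
      intro z
      rw [← Real.exp_nat_mul]; norm_num
    have hqm : Measurable fun x : ℝ => ENNReal.ofReal (x ^ 2) :=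
      (measurable_id.pow_const 2).ennreal_ofReal
    rw [logNormal, lintegral_map hqm Real.measurable_exp]
    simp only [e, lintegral_exp_mul_gaussianReal a hv]
    exact ENNReal.ofReal_ne_top
  · intro c hc
    -- With Chernoff parameter `τ = √(log s) ≥ 1` and cutoff `exp (b τ)`, the moment terms are at
    -- most `(4 |a| + 8 v) τ²`. The final `1` in `b` leaves `-τ² = -log s`, the required factor `1 /
    -- s`.
    set b := 4 * |a| + 8 * v + 1 with hb
    have hb0 : 0 < b := by positivity
    refine ⟨b + 1, ?_⟩
    filter_upwards [hg.eventually_ge_atTop 1, hg.eventually_ge_atTop (Real.log (1 + c)),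
      eventually_gt_atTop 1] with s h1 h2 hs
    have hls : 0 < Real.log s := Real.log_pos hs
    set τ := Real.sqrt (Real.log s) with hτ
    have hτ2 : τ ^ 2 = Real.log s := Real.sq_sqrt hls.le
    have hs0 : 0 < s := by linarith
    have hse : s = Real.exp (τ ^ 2) := by rw [hτ2, Real.exp_log hs0]
    refine ⟨Real.exp (b * τ), Real.exp_pos _, ?_, ?_⟩
    · refine (setLIntegral_sq_logNormal_le (τ := τ) hv (by linarith)).trans ?_
      apply ENNReal.ofReal_le_ofReal
      rw [hse, ← Real.exp_sub]
      apply Real.exp_le_exp.2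
      have ha : a ≤ |a| := le_abs_self a
      have h3 : 2 * a * (1 + τ) ≤ 4 * |a| * τ ^ 2 := by
        have h7 : a * (1 + τ) ≤ |a| * (2 * τ ^ 2) :=
          mul_le_mul ha (by nlinarith) (by linarith) (abs_nonneg a)
        linarith
      have h4 : 2 * v * (1 + τ) ^ 2 ≤ 8 * v * τ ^ 2 := by
        have : (1 + τ) ^ 2 ≤ (2 * τ) ^ 2 := pow_le_pow_left₀ (by linarith) (by linarith) 2
        nlinarith
      have h5 : 0 ≤ b * τ := by positivity
      have h6 : τ * (b * τ) = 4 * |a| * τ ^ 2 + 8 * v * τ ^ 2 + τ ^ 2 := by rw [hb]; ring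
      linarith
    · have h3 : 1 ≤ Real.exp (b * τ) := Real.one_le_exp (by positivity)
      calc Real.log (1 + c * Real.exp (b * τ)) ≤ Real.log ((1 + c) * Real.exp (b * τ)) :=
            Real.log_le_log (by positivity) (by nlinarith)
        _ = Real.log (1 + c) + b * τ := by
            rw [Real.log_mul (by positivity) (Real.exp_pos _).ne', Real.log_exp]
        _ ≤ _ := by linarith
  · intro c hc
    have hsv : 0 < Real.sqrt v := Real.sqrt_pos.2 hv
    -- At `x = √v τ` the exponent `x² / v` equals `log s`. The level `exp (2 x)` has logarithm `2 √v
    -- τ`; one half is kept and the other absorbs a negative `log c`.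
    refine ⟨Real.sqrt v, hsv,
      (Real.sqrt (2 * Real.pi * v))⁻¹ * Real.exp (-((1 + |a|) ^ 2 / v)), by positivity, ?_⟩
    filter_upwards [hg.eventually_ge_atTop (-Real.log c / Real.sqrt v),
      eventually_gt_atTop 1] with s h1 hs
    have hls : 0 < Real.log s := Real.log_pos hs
    set τ := Real.sqrt (Real.log s) with hτ
    have hτ0 : 0 ≤ τ := Real.sqrt_nonneg _
    have hτ2 : τ ^ 2 = Real.log s := Real.sq_sqrt hls.le
    have hs0 : 0 < s := by linarith
    refine ⟨Real.exp (2 * (Real.sqrt v * τ)), (Real.exp_pos _).le, ?_, ?_⟩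
    · refine le_trans (le_of_eq ?_) (le_logNormal_tail (a := a) hv (by positivity))
      have e1 : (Real.sqrt v * τ) ^ 2 / v = Real.log s := by
        rw [mul_pow, Real.sq_sqrt hv.le, hτ2]
        field_simp
      rw [e1, Real.exp_sub, Real.exp_log hs0, mul_div_assoc]
    · rw [div_le_iff₀ hsv] at h1
      calc Real.sqrt v * τ ≤ Real.log c + 2 * (Real.sqrt v * τ) := by linarith
        _ = Real.log (c * Real.exp (2 * (Real.sqrt v * τ))) := by
            rw [Real.log_mul hc.ne' (Real.exp_pos _).ne', Real.log_exp]
        _ ≤ _ := Real.log_le_log (by positivity) (by linarith)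

end LogNormal

end OFDMA

theorem lemma4 (α β r₀ R P κ₁ κ₂ : ℝ) (hα : 1 < α) (hβ : 0 < β) (hr₀ : 0 < r₀) (hR : r₀ < R)
    (hP : 0 < P) (hκ₁ : 0 < κ₁) (hκ₂ : 0 < κ₂) :
    (∀ m w : ℝ, 0 < m → 0 < w →
      OFDMA.HasScalingLaw.{v} α β r₀ R P κ₁ κ₂ (OFDMA.nakagami m w)
        (fun ρ => Real.log (Real.log ρ))) ∧
    (∀ l t : ℝ, 0 < l → 0 < t →
      OFDMA.HasScalingLaw.{v} α β r₀ R P κ₁ κ₂ (OFDMA.weibull l t)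
        (fun ρ => Real.log (Real.log ρ ^ (2 / t)))) ∧
    (∀ a v : ℝ, 0 < v →
      OFDMA.HasScalingLaw.{v} α β r₀ R P κ₁ κ₂ (OFDMA.logNormal a v)
        (fun ρ => Real.sqrt (Real.log ρ))) :=
  ⟨fun _ _ hm hw => (OFDMA.hasTailProfile_nakagami hm hw).hasScalingLaw hα hβ hr₀ hR hP hκ₁ hκ₂,
    fun _ _ hl ht => (OFDMA.hasTailProfile_weibull hl ht).hasScalingLaw hα hβ hr₀ hR hP hκ₁ hκ₂,
    fun _ _ hv => (OFDMA.hasTailProfile_logNormal hv).hasScalingLaw hα hβ hr₀ hR hP hκ₁ hκ₂⟩
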